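/- Fix a field $\mathbb F$ and $n\in\mathbb N$. A \emph{zigzag module of length $n$} is a sequence $\mathbb V=(V_1\leftrightarrow V_2\leftrightarrow\cdots\leftrightarrow V_n)$ of finite-dimensional $\mathbb F$-vector spaces with one linear map $p_i$ between $V_i$ and $V_{i+1}$, in either direction, for each $1\le i<n$; its \emph{type} $\tau\in\{\rightarrow,\leftarrow\}^{n-1}$ records the directions. Write $n\text{-Mod}$ for the collection of all of them. Isomorphisms and direct sums of zigzag modules of the same type are taken componentwise. For $1\le b\le d\le n$ the interval module $\mathbb I_\tau([b,d])$ has $\mathbb F$ at the indices $b\le i\le d$, $0$ elsewhere, identity maps between consecutive copies of $\mathbb F$, and zero maps otherwise. Every $\mathbb V$ of type $\tau$ is isomorphic to a finite direct sum of interval modules $\mathbb I_\tau([b_j,d_j])$, unique up to order, and $\mathrm{Dgm}(\mathbb V)$ is the multiset of the points $(b_j,d_j)\in\mathbb R^2$. Let $\mathcal S(\mathbb V)$ be the direct sum of the $\mathbb I_\tau([b,d])$ over all $(b,d)\in\mathrm{Dgm}(\mathbb V)$ with $b\neq d$. Write $\mathbb V\sim\mathbb W$ if, up to isomorphism, $\mathbb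 W$ is obtained from $\mathbb V$ by finitely many (possibly no) steps, each replacing a structure map that is an isomorphism by its inverse, pointing in the opposite direction. Write $\mathbb W\precsim\mathbb V$ if $\mathbb W\sim\mathbb W'$ for some direct summand $\mathbb W'$ of $\mathbb V$ (up to isomorphism, of the same type as $\mathbb V$). For $1\le k\le n$ the reflection $\mathcal L_k$ replaces the part $V_{k-1}\leftrightarrow V_k\leftrightarrow V_{k+1}$ of $\mathbb V$ by $V_{k-1}\leftarrow L\rightarrow V_{k+1}$, where $L$ is the limit of that part with its canonical maps, and $\mathcal C_k$ replaces it by $V_{k-1}\rightarrow C\leftarrow V_{k+1}$, where $C$ is its colimit. At $k=1$ (resp. $k=n$) the missing space $V_0$ (resp. $V_{n+1}$) is taken to be $0$, the direction of the added zero map is chosen freely for each reflection, and the added space is dropped afterwards. For a finite, possibly empty, sequence $\mathfrak R=(\mathcal R_\ell,\dots,\mathcal R_1)$ of such reflections put $$\mathfrak R(\mathbb V)=(\mathcal S\circ\mathcal R_\ell\circ\mathcal S\circ\cdots\circ\mathcal S\circ\mathcal R_1\circ\mathcal S)(\mathbb V),\qquad C_1(\mathfrak R)=\ell .$$ The ($1$-)reflection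 distance is $$d^1_{\mathcal R}(\mathbb V,\mathbb W)=\min\bigl\{\max\{C_1(\mathfrak R),C_1(\mathfrak R')\}\ :\ \mathfrak R(\mathbb V)\precsim\mathbb W,\ \mathfrak R'(\mathbb W)\precsim\mathbb V\bigr\}.$$ For finite multisets $S,T$ of points of $\mathbb R^2$, a matching $M$ between $S$ and $T$ is a bijection between a submultiset of $S$ and a submultiset of $T$, its cost is $$c_\infty(M)=\max\Bigl\{\max_{(s,t)\in M}\|s-t\|_\infty,\ \max_{r\in S\sqcup T\text{ unmatched}}\tfrac12|r_y-r_x|\Bigr\}$$ (a maximum over the empty set being $0$), and the bottleneck distance is $d_b^\infty(S,T)=\inf_M c_\infty(M)$. \textbf{Corollary.} For all $\mathbb V,\mathbb W\in n\text{-Mod}$ (not necessarily of the same type), $$d_b^\infty(\mathrm{Dgm}(\mathbb V),\mathrm{Dgm}(\mathbb W))\le d^1_{\mathcal R}(\mathbb V,\mathbb W).$$ -/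

import Mathlib

open scoped ENNReal

set_option linter.unusedVariables false

universe u

noncomputable section

namespace Zigzag

/-! ### Types of zigzag modules -/

/-- The direction of an arrow, read from left to right. -/
inductive Dir
  | fwd
  | bwd
  deriving DecidableEq

/-- The reversed direction. -/
def Dir.rev : Dir → Dir
  | .fwd => .bwd
  | .bwd => .fwd

/-- The set `{→, ←}^(n-1)` of types of zigzag modules of length `n`. -/
abbrev ZType (n : ℕ) : Type := Fin (n - 1) → Dir

/-- The left endpoint of the `i`-th arrow. (Vertices and arrows are numbered from `0`.) -/
def lo {n : ℕ} (i : Fin (n - 1)) : Fin n := ⟨i.1, by omega⟩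

/-- The right endpoint of the `i`-th arrow. -/
def hi {n : ℕ} (i : Fin (n - 1)) : Fin n := ⟨i.1 + 1, by omega⟩

/-- Reversal of the `k`-th arrow of a type. -/
def ZType.reverse {n : ℕ} (k : Fin (n - 1)) (τ : ZType n) : ZType n :=
  fun i => if i = k then (τ i).rev else τ i

/-- Replace the arrow to the left of vertex `k` by `dl` and the arrow to the right of vertex `k` by
`dr` (as far as these arrows exist). -/
def ZType.place {n : ℕ} (k : Fin n) (dl dr : Dir) (τ : ZType n) : ZType n :=
  fun i => if hi i = k then dl else if lo i = k then dr else τ i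

/-- Placing a source at vertex `k`. -/
def ZType.extrovert {n : ℕ} (k : Fin n) (τ : ZType n) : ZType n := τ.place k .bwd .fwd

/-- Placing a sink at vertex `k`. -/
def ZType.introvert {n : ℕ} (k : Fin n) (τ : ZType n) : ZType n := τ.place k .fwd .bwd

variable {F : Type u} [Field F] {n : ℕ}

/-! ### Structure maps -/

/-- A linear map between `A` and `B` in the prescribed direction. -/
def StructMap (d : Dir) (A B : FGModuleCat.{u} F) : Type u :=
  match d with
  | .fwd => A →ₗ[F] B
  | .bwd => B →ₗ[F] A

namespace StructMap

/-- The zero map in either direction. -/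
protected def zero : (d : Dir) → (A B : FGModuleCat.{u} F) → StructMap d A B
  | .fwd, A, B => (0 : A →ₗ[F] B)
  | .bwd, A, B => (0 : B →ₗ[F] A)

/-- Transport of a structure map along equalities of its direction and its endpoints. -/
protected def cast {d d' : Dir} {A A' B B' : FGModuleCat.{u} F} (hd : d = d') (hA : A = A')
    (hB : B = B') (f : StructMap d A B) : StructMap d' A' B' := by
  subst hd hA hB
  exact f

/-- Commutativity of the square formed by two parallel structure maps and two vertical maps. -/
def Comm : (d : Dir) → {A B A' B' : FGModuleCat.{u} F} → StructMap d A B → StructMap d A' B' →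
    (A →ₗ[F] A') → (B →ₗ[F] B') → Prop
  | .fwd, A, B, A', B', (f : A →ₗ[F] B), (g : A' →ₗ[F] B'), φ, ψ => ψ ∘ₗ f = g ∘ₗ φ
  | .bwd, A, B, A', B', (f : B →ₗ[F] A), (g : B' →ₗ[F] A'), φ, ψ => φ ∘ₗ f = g ∘ₗ ψ

/-- The structure map is an isomorphism. -/
def IsIso : (d : Dir) → {A B : FGModuleCat.{u} F} → StructMap d A B → Prop
  | .fwd, A, B, (f : A →ₗ[F] B) => Function.Bijective f
  | .bwd, A, B, (f : B →ₗ[F] A) => Function.Bijective f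

/-- The inverse of an invertible structure map, pointing in the opposite direction. -/
def inv : (d : Dir) → {A B : FGModuleCat.{u} F} → (f : StructMap d A B) → IsIso d f →
    StructMap d.rev A B
  | .fwd, A, B, (f : A →ₗ[F] B), h =>
      ((LinearEquiv.ofBijective f h).symm.toLinearMap : B →ₗ[F] A)
  | .bwd, A, B, (f : B →ₗ[F] A), h =>
      ((LinearEquiv.ofBijective f h).symm.toLinearMap : A →ₗ[F] B)

/-- The direct sum of two structure maps of the same direction. -/
protected def prod : (d : Dir) → {A B A' B' : FGModuleCat.{u} F} → StructMap d A B →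
    StructMap d A' B' → StructMap d (FGModuleCat.of F (A × A')) (FGModuleCat.of F (B × B'))
  | .fwd, A, B, A', B', (f : A →ₗ[F] B), (g : A' →ₗ[F] B') =>
      (f.prodMap g : (A × A') →ₗ[F] (B × B'))
  | .bwd, A, B, A', B', (f : B →ₗ[F] A), (g : B' →ₗ[F] A') =>
      (f.prodMap g : (B × B') →ₗ[F] (A × A'))

/-- The direct sum of a finite family of structure maps of the same direction. -/
protected def pi {ι : Type} [Finite ι] : (d : Dir) → {A B : ι → FGModuleCat.{u} F} →
    (∀ x, StructMap d (A x) (B x)) →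
    StructMap d (FGModuleCat.of F (∀ x, A x)) (FGModuleCat.of F (∀ x, B x))
  | .fwd, A, B, (f : ∀ x, A x →ₗ[F] B x) =>
      (LinearMap.pi fun x => f x ∘ₗ LinearMap.proj x : (∀ x, A x) →ₗ[F] (∀ x, B x))
  | .bwd, A, B, (f : ∀ x, B x →ₗ[F] A x) =>
      (LinearMap.pi fun x => f x ∘ₗ LinearMap.proj x : (∀ x, B x) →ₗ[F] (∀ x, A x))

/-- The pairs in `A × B` which are compatible with the structure map, i.e. its graph. -/
def graph : (d : Dir) → {A B : FGModuleCat.{u} F} → StructMap d A B → Submodule F (A × B)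
  | .fwd, A, B, (f : A →ₗ[F] B) => LinearMap.eqLocus (f ∘ₗ LinearMap.fst F A B) (LinearMap.snd F A B)
  | .bwd, A, B, (f : B →ₗ[F] A) => LinearMap.eqLocus (LinearMap.fst F A B) (f ∘ₗ LinearMap.snd F A B)

/-- The relations in `A × B` identifying each element of the domain with its image. -/
def relations : (d : Dir) → {A B : FGModuleCat.{u} F} → StructMap d A B → Submodule F (A × B)
  | .fwd, A, B, (f : A →ₗ[F] B) => LinearMap.range ((LinearMap.id : A →ₗ[F] A).prod (-f))
  | .bwd, A, B, (f : B →ₗ[F] A) => LinearMap.range ((-f).prod (LinearMap.id : B →ₗ[F] B))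

end StructMap

/-! ### Zigzag modules -/

/-- A zigzag module of type `τ`: finite-dimensional spaces `V_i`, and between `V_i` and `V_{i+1}` a
linear map in the direction `τ i`. -/
structure TauMod (F : Type u) [Field F] {n : ℕ} (τ : ZType n) where
  space : Fin n → FGModuleCat.{u} F
  map : ∀ i : Fin (n - 1), StructMap (τ i) (space (lo i)) (space (hi i))

/-- Zigzag modules of length `n`, of any type. -/
abbrev NMod (F : Type u) [Field F] (n : ℕ) : Type (u + 1) := Σ τ : ZType n, TauMod F τ

namespace TauMod

variable {τ : ZType n}

/-- Isomorphism of zigzag modules of the same type. -/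
def Iso (V W : TauMod F τ) : Prop :=
  ∃ e : ∀ i, V.space i ≃ₗ[F] W.space i, ∀ i : Fin (n - 1),
    StructMap.Comm (τ i) (V.map i) (W.map i) (e (lo i)).toLinearMap (e (hi i)).toLinearMap

/-- The direct sum of two zigzag modules of the same type. -/
def sum (V W : TauMod F τ) : TauMod F τ where
  space i := FGModuleCat.of F (V.space i × W.space i)
  map i := StructMap.prod (τ i) (V.map i) (W.map i)

/-- The direct sum of a finite family of zigzag modules of the same type. The empty direct sum is
the zero module. -/
def directSum {ι : Type} [Finite ι] (V : ι → TauMod F τ) : TauMod F τ where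
  space i := FGModuleCat.of F (∀ x, (V x).space i)
  map i := StructMap.pi (τ i) fun x => (V x).map i

/-- `W` is a summand of `V`. -/
def IsSummand (W V : TauMod F τ) : Prop := ∃ U : TauMod F τ, Iso V (W.sum U)

end TauMod

/-! ### Interval modules and persistence diagrams -/

/-- The space at vertex `i` of the interval module on `[b, d]`: the functions from the proof(s) of
`b ≤ i ≤ d` to `F`, i.e. one copy of `F` if `b ≤ i ≤ d`, and the zero space otherwise. -/
def intervalSpace (F : Type u) [Field F] (b d i : Fin n) : FGModuleCat.{u} F :=
  FGModuleCat.of F (PLift (b ≤ i ∧ i ≤ d) → F)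

/-- The identity of `F` if both `i` and `j` lie in `[b, d]`, and zero otherwise. -/
def intervalMap (F : Type u) [Field F] (b d i j : Fin n) :
    intervalSpace F b d i →ₗ[F] intervalSpace F b d j :=
  LinearMap.pi fun _ : PLift (b ≤ j ∧ j ≤ d) =>
    if h : b ≤ i ∧ i ≤ d then
      (LinearMap.proj (PLift.up h) : (PLift (b ≤ i ∧ i ≤ d) → F) →ₗ[F] F)
    else 0

/-- The interval module of type `τ` on `[b, d]`. -/
def interval (F : Type u) [Field F] (τ : ZType n) (b d : Fin n) : TauMod F τ where
  space i := intervalSpace F b d i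
  map i :=
    match τ i with
    | .fwd => intervalMap F b d (lo i) (hi i)
    | .bwd => intervalMap F b d (hi i) (lo i)

/-- The direct sum of the interval modules on the intervals of a finite multiset. -/
def intervalSum (F : Type u) [Field F] (τ : ZType n) (D : Multiset (Fin n × Fin n)) : TauMod F τ :=
  TauMod.directSum fun x : D.ToType => interval F τ x.1.1 x.1.2

/-- `D` is the multiset of intervals of an interval decomposition of `V`. -/
def IsDiagram {τ : ZType n} (V : TauMod F τ) (D : Multiset (Fin n × Fin n)) : Prop :=
  (∀ x ∈ D, x.1 ≤ x.2) ∧ V.Iso (intervalSum F τ D)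

open Classical in
/-- The persistence diagram of a zigzag module, as the multiset of intervals of its interval
decomposition. (Every zigzag module has such a decomposition, and it is unique; hence the value in
the `else` branch is irrelevant.) -/
def dgmIntervals {τ : ZType n} (V : TauMod F τ) : Multiset (Fin n × Fin n) :=
  if h : ∃ D, IsDiagram V D then h.choose else 0

/-- The persistence diagram of a zigzag module, as a multiset of points `(b, d)` of the plane. The
vertices are numbered from `1` to `n` here. -/
def dgm (V : NMod F n) : Multiset (ℝ × ℝ) :=
  (dgmIntervals V.2).map fun x => ((x.1 : ℕ) + 1, (x.2 : ℕ) + 1)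

/-- Removal of the simple summands. -/
def removeSimple (V : NMod F n) : NMod F n :=
  ⟨V.1, intervalSum F V.1 ((dgmIntervals V.2).filter fun x => x.1 ≠ x.2)⟩

/-! ### Arrow reversals -/

/-- Reversal of the `k`-th arrow of a zigzag module, which has to be an isomorphism. -/
def TauMod.reverse {τ : ZType n} (V : TauMod F τ) (k : Fin (n - 1))
    (hk : StructMap.IsIso (τ k) (V.map k)) : TauMod F (τ.reverse k) where
  space := V.space
  map i :=
    if h : i = k then
      StructMap.cast (by simp [ZType.reverse, h]) rfl rfl
        (StructMap.inv (τ i) (V.map i) (h ▸ hk))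
    else
      StructMap.cast (by simp [ZType.reverse, h]) rfl rfl (V.map i)

/-- `V ∼ W`: up to isomorphism, `W` is obtained from `V` by finitely many (possibly no) reversals of
arrows which are isomorphisms. -/
inductive Equivalent : NMod F n → NMod F n → Prop
  | of_iso {τ : ZType n} {V W : TauMod F τ} : V.Iso W → Equivalent ⟨τ, V⟩ ⟨τ, W⟩
  | of_reverse {τ : ZType n} (V : TauMod F τ) (k : Fin (n - 1))
      (hk : StructMap.IsIso (τ k) (V.map k)) {W : NMod F n} :
      Equivalent ⟨τ.reverse k, V.reverse k hk⟩ W → Equivalent ⟨τ, V⟩ W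

/-- `W ≾ V`: `W` is equivalent to a summand of `V`. -/
def PrecSim (W V : NMod F n) : Prop :=
  ∃ W' : TauMod F V.1, Equivalent W ⟨V.1, W'⟩ ∧ W'.IsSummand V.2

/-! ### Reflections -/

/-- An arrow between some space and `B`, on the left of `B`. -/
structure LeftArrow (B : FGModuleCat.{u} F) where
  space : FGModuleCat.{u} F
  dir : Dir
  map : StructMap dir space B

/-- An arrow between `B` and some space, on the right of `B`. -/
structure RightArrow (B : FGModuleCat.{u} F) where
  space : FGModuleCat.{u} F
  dir : Dir
  map : StructMap dir B space

namespace TauMod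

variable {τ : ZType n}

/-- The arrow to the left of vertex `k`. At the first vertex this is the zero map between `0` and
the first space, in direction `d₀`. -/
def leftArrow (V : TauMod F τ) (d₀ : Dir) : (k : Fin n) → LeftArrow (V.space k)
  | ⟨0, _⟩ => ⟨FGModuleCat.of F PUnit.{u + 1}, d₀, StructMap.zero d₀ _ _⟩
  | ⟨j + 1, h⟩ => ⟨V.space ⟨j, by omega⟩, τ ⟨j, by omega⟩, V.map ⟨j, by omega⟩⟩

/-- The arrow to the right of vertex `k`. At the last vertex this is the zero map between the last
space and `0`, in direction `d₀`. -/
def rightArrow (V : TauMod F τ) (d₀ : Dir) (k : Fin n) : RightArrow (V.space k) :=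
  if h : k.1 < n - 1 then
    ⟨V.space (hi ⟨k.1, h⟩), τ ⟨k.1, h⟩, V.map ⟨k.1, h⟩⟩
  else ⟨FGModuleCat.of F PUnit.{u + 1}, d₀, StructMap.zero d₀ _ _⟩

end TauMod

section Local

variable {B : FGModuleCat.{u} F} (l : LeftArrow B) (r : RightArrow B)

/-- The limit of the diagram `A ↔ B ↔ C`, as the space of compatible triples in `A × B × C`. -/
def limSubmodule : Submodule F (l.space × B × r.space) :=
  (StructMap.graph l.dir l.map).comap
      ((LinearMap.fst F l.space (B × r.space)).prod
        (LinearMap.fst F B r.space ∘ₗ LinearMap.snd F l.space (B × r.space))) ⊓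
    (StructMap.graph r.dir r.map).comap (LinearMap.snd F l.space (B × r.space))

/-- The limit of the diagram `A ↔ B ↔ C`. -/
def lim : FGModuleCat.{u} F := FGModuleCat.of F (limSubmodule l r)

/-- The projection of the limit to `A`. -/
def limToLeft : lim l r →ₗ[F] l.space :=
  LinearMap.fst F l.space (B × r.space) ∘ₗ (limSubmodule l r).subtype

/-- The projection of the limit to `C`. -/
def limToRight : lim l r →ₗ[F] r.space :=
  LinearMap.snd F B r.space ∘ₗ LinearMap.snd F l.space (B × r.space) ∘ₗ (limSubmodule l r).subtype

/-- The relations defining the colimit of the diagram `A ↔ B ↔ C` as a quotient of `A × B × C`. -/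
def colimSubmodule : Submodule F (l.space × B × r.space) :=
  (StructMap.relations l.dir l.map).map
      ((LinearMap.id : l.space →ₗ[F] l.space).prodMap (LinearMap.inl F B r.space)) ⊔
    (StructMap.relations r.dir r.map).map (LinearMap.inr F l.space (B × r.space))

/-- The colimit of the diagram `A ↔ B ↔ C`. -/
def colim : FGModuleCat.{u} F := FGModuleCat.of F ((l.space × B × r.space) ⧸ colimSubmodule l r)

/-- The canonical map from `A` to the colimit. -/
def leftToColim : l.space →ₗ[F] colim l r :=
  (colimSubmodule l r).mkQ ∘ₗ LinearMap.inl F l.space (B × r.space)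

/-- The canonical map from `C` to the colimit. -/
def rightToColim : r.space →ₗ[F] colim l r :=
  (colimSubmodule l r).mkQ ∘ₗ LinearMap.inr F l.space (B × r.space) ∘ₗ LinearMap.inr F B r.space

end Local

namespace TauMod

variable {τ : ZType n}

theorem leftArrow_hi (V : TauMod F τ) (d₀ : Dir) (i : Fin (n - 1)) :
    (V.leftArrow d₀ (hi i)).space = V.space (lo i) := rfl

theorem rightArrow_lo (V : TauMod F τ) (d₀ : Dir) (i : Fin (n - 1)) :
    (V.rightArrow d₀ (lo i)).space = V.space (hi i) := by
  have h : (lo i).1 < n - 1 := i.2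
  simp only [rightArrow, h, dif_pos]
  rfl

/-- Replace the space at vertex `k` by `L`, the arrow to the left of `k` by the map `f`, which has
direction `dl`, and the arrow to the right of `k` by the map `g`, which has direction `dr`. (At an
end of the zigzag there is no arrow on the outer side, and the map given for it is not used.) -/
def replace (V : TauMod F τ) (k : Fin n) (dl dr d₀ : Dir) (L : FGModuleCat.{u} F)
    (f : StructMap dl (V.leftArrow d₀ k).space L) (g : StructMap dr L (V.rightArrow d₀ k).space) :
    TauMod F (τ.place k dl dr) where
  space := Function.update V.space k L
  map i :=
    if h : hi i = k then
      StructMap.cast (by simp [ZType.place, h])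
        (by
          subst h
          rw [Function.update_of_ne (by simp [lo, hi, Fin.ext_iff]), leftArrow_hi])
        (by rw [h, Function.update_self]) f
    else if h' : lo i = k then
      StructMap.cast (by simp [ZType.place, h, h'])
        (by rw [h', Function.update_self])
        (by rw [Function.update_of_ne h]; subst h'; rw [rightArrow_lo]) g
    else
      StructMap.cast (by simp [ZType.place, h, h'])
        (by rw [Function.update_of_ne h']) (by rw [Function.update_of_ne h]) (V.map i)

/-- The extroversion reflection at vertex `k`: the part of the module around vertex `k` is replaced
by its limit. The direction `d₀` only matters at the first and at the last vertex, where it is the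
direction of the added zero map. -/
def extrovert (V : TauMod F τ) (k : Fin n) (d₀ : Dir) : TauMod F (τ.extrovert k) :=
  V.replace k .bwd .fwd d₀ (lim (V.leftArrow d₀ k) (V.rightArrow d₀ k))
    (limToLeft (V.leftArrow d₀ k) (V.rightArrow d₀ k))
    (limToRight (V.leftArrow d₀ k) (V.rightArrow d₀ k))

/-- The introversion reflection at vertex `k`: the part of the module around vertex `k` is replaced
by its colimit. The direction `d₀` only matters at the first and at the last vertex, where it is the
direction of the added zero map. -/
def introvert (V : TauMod F τ) (k : Fin n) (d₀ : Dir) : TauMod F (τ.introvert k) :=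
  V.replace k .fwd .bwd d₀ (colim (V.leftArrow d₀ k) (V.rightArrow d₀ k))
    (leftToColim (V.leftArrow d₀ k) (V.rightArrow d₀ k))
    (rightToColim (V.leftArrow d₀ k) (V.rightArrow d₀ k))

end TauMod

/-- A reflection functor: a limit or colimit reflection at some vertex, together with the direction
of the added zero map (which only matters at the first and at the last vertex). -/
inductive Reflection (n : ℕ) : Type
  | limit (k : Fin n) (d₀ : Dir)
  | colimit (k : Fin n) (d₀ : Dir)

/-- The action of a reflection functor on zigzag modules. -/
def Reflection.apply (V : NMod F n) : Reflection n → NMod F n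
  | .limit k d₀ => ⟨V.1.extrovert k, V.2.extrovert k d₀⟩
  | .colimit k d₀ => ⟨V.1.introvert k, V.2.introvert k d₀⟩

/-- The action of a sequence of reflection functors (the rightmost one is applied first), where
simple summands are removed at the beginning and after each reflection. -/
def applySeq (V : NMod F n) : List (Reflection n) → NMod F n
  | [] => removeSimple V
  | R :: l => removeSimple (R.apply (applySeq V l))

/-! ### The reflection distance -/

/-- The `p`-cost of a sequence of reflection functors. -/
def seqCost (p : ℝ) (l : List (Reflection n)) : ℝ :=
  if l = [] then 0 else (l.length : ℝ) ^ (1 / p)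

/-- The `p`-reflection distance. -/
def reflectionDist (p : ℝ) (V W : NMod F n) : ℝ :=
  sInf {c : ℝ | ∃ l l' : List (Reflection n), PrecSim (applySeq V l) W ∧
    PrecSim (applySeq W l') V ∧ c = max (seqCost p l) (seqCost p l')}

/-! ### The bottleneck distance -/

/-- A matching between two sets. -/
structure Matching (S T : Type) where
  rel : S → T → Prop
  right_unique : ∀ s t t', rel s t → rel s t' → t = t'
  left_unique : ∀ s s' t, rel s t → rel s' t → s = s'

/-- The contribution of an unmatched point to the cost of a matching. -/
def diagCost (p : ℝ≥0∞) (r : ℝ × ℝ) : ℝ := |r.2 - r.1| / 2 ^ (1 - (1 / p).toReal)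

/-- The cost of a matching between two (finite) multisets of points of the plane; the maximum over
an empty set is `0`. -/
def matchingCost (p : ℝ≥0∞) {S T : Multiset (ℝ × ℝ)} (M : Matching S.ToType T.ToType) : ℝ :=
  max (⨆ x : {x : S.ToType × T.ToType // M.rel x.1 x.2},
        ‖WithLp.toLp p x.1.1.1 - WithLp.toLp p x.1.2.1‖)
    (max (⨆ s : {s : S.ToType // ∀ t, ¬ M.rel s t}, diagCost p s.1.1)
      (⨆ t : {t : T.ToType // ∀ s, ¬ M.rel s t}, diagCost p t.1.1))

/-- The `ℓ^p`-bottleneck distance between two finite multisets of points of the plane. -/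
def bottleneckDist (p : ℝ≥0∞) (S T : Multiset (ℝ × ℝ)) : ℝ :=
  ⨅ M : Matching S.ToType T.ToType, matchingCost p M

end Zigzag

end

/-!
A reflection at vertex `k` changes an interval module only at `k`, and the result is again an
interval module or zero; since reflections are additive, a reflection acts on the intervals of a
decomposition one by one. Hence, under a sequence of `m` reflections with removal of simple
summands, each interval of `V` either survives, with endpoints moved by at most `m`, or is
removed, in which case its length `d - b` was at most `m` (`exists_tracked`). If the outcome is
equivalent to a summand of `W`, then the surviving intervals are intervals of `W`, because arrow
reversals do not change the intervals and the decomposition of `W` is unique. This gives a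
matching of cost at most `m` except that intervals of `W` may be left over
(`exists_matching_of_precSim`). The two sequences in the definition of the reflection distance
give two such matchings, in opposite directions, and alternating paths combine them into one which
leaves only short intervals unmatched on either side (`exists_common_matching`).

Decompositions are handled through coordinates (`Decomp`): a fixed index set `X`, a support `s x`
for each `x : X`, possibly empty, and linear maps from the spaces to `X → F` in which every
structure map is the identity on common coordinates. Reflections then only change the supports.

* Existence (`exists_decomp`): induction on the number of vertices. The claim is strengthened to
  decompositions which are compatible with a given chain of subspaces of the last space; this lets
  the kernel or the range of the next map, and the preimages or images of the next chain, be
  passed on to the shorter module, and no change of basis has to be carried back along the zigzag.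
* Uniqueness (`Decomp.unique`): the number of intervals containing both `b` and `d` is the
  dimension of the space of initial vectors of sections over `[b, d]`, modulo those of sections
  vanishing at `d` (`card_contains`).
* The set of admissible pairs of sequences is nonempty (`exists_precSim`), so that the infimum has
  its intended meaning: every module can be reflected to zero.
-/

namespace Zigzag

variable {F : Type u} [Field F] {n : ℕ} {X Y : Type} {τ : ZType n}

/-! ### Adapted coordinates -/

/-- Coordinates: `c` identifies the space `A` with the functions on `X` supported on `p`. -/
structure IsCoord {A : Type*} [AddCommGroup A] [Module F A]
    (c : A →ₗ[F] (X → F)) (p : X → Prop) : Prop where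
  inj : ∀ a, c a = 0 → a = 0
  supp : ∀ a x, ¬ p x → c a x = 0
  surj : ∀ f : X → F, (∀ x, ¬ p x → f x = 0) → ∃ a, c a = f

open Classical in
/-- In the given coordinates the structure map is the identity wherever both coordinates exist, and
zero otherwise. -/
def Compat : (d : Dir) → {A B : FGModuleCat.{u} F} →
    StructMap d A B → (A →ₗ[F] (X → F)) → (B →ₗ[F] (X → F)) → (X → Prop) → (X → Prop) → Prop
  | .fwd, A, B, (f : A →ₗ[F] B), cA, cB, _, q => ∀ a x, cB (f a) x = if q x then cA a x else 0
  | .bwd, A, B, (f : B →ₗ[F] A), cA, cB, p, _ => ∀ b x, cA (f b) x = if p x then cB b x else 0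

theorem IsCoord.ext {A : Type*} [AddCommGroup A] [Module F A] {c : A →ₗ[F] (X → F)} {p : X → Prop}
    (h : IsCoord c p) {a b : A} (hab : ∀ x, c a x = c b x) : a = b := by
  rw [← sub_eq_zero]
  apply h.inj
  rw [map_sub, sub_eq_zero]
  exact funext hab

open Classical in
theorem IsCoord.exists_single {A : Type*} [AddCommGroup A] [Module F A] {c : A →ₗ[F] (X → F)}
    {p : X → Prop} (h : IsCoord c p) {x : X} (hx : p x) : ∃ a, c a = Pi.single x 1 :=
  h.surj _ fun y hy => by
    rw [Pi.single_eq_of_ne]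
    rintro rfl
    exact hy hx

/-- An isomorphism which is compatible with the coordinates does not see the end of any interval. -/
theorem Compat.iff_of_isIso {d : Dir} {A B : FGModuleCat.{u} F} {f : StructMap d A B}
    {cA : A →ₗ[F] (X → F)} {cB : B →ₗ[F] (X → F)} {p q : X → Prop} (h : Compat d f cA cB p q)
    (hA : IsCoord cA p) (hB : IsCoord cB q) (hf : StructMap.IsIso d f) (x : X) : p x ↔ q x := by
  classical
  have key : ∀ {A B : FGModuleCat.{u} F} {cA : A →ₗ[F] (X → F)} {cB : B →ₗ[F] (X → F)}
      {p q : X → Prop} (hA : IsCoord cA p) (hB : IsCoord cB q) (f : A →ₗ[F] B)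
      (hf : Function.Bijective f) (h : ∀ a x, cB (f a) x = if q x then cA a x else 0),
      p x ↔ q x := by
    intro A B cA cB p q hA hB f hf h
    by_cases hp : p x <;> by_cases hq : q x <;> simp only [hp, hq, iff_true, iff_false, not_true]
    · obtain ⟨a, ha⟩ := hA.exists_single hp
      have h0 : f a = 0 := hB.inj _ (by
        ext y
        rw [h, ha]
        by_cases hy : y = x
        · subst hy; simp [hq]
        · simp [hy])
      have : a = 0 := hf.1 (by rw [h0, map_zero])
      have := congrFun ha x
      simp_all
    · obtain ⟨b, hb⟩ := hB.exists_single hq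
      obtain ⟨a, rfl⟩ := hf.2 b
      have := congrFun hb x
      rw [h, hA.supp a x hp] at this
      simp at this
  cases d
  · exact key hA hB f hf h
  · exact (key hB hA f hf h).symm

theorem Compat.inv {d : Dir} {A B : FGModuleCat.{u} F} {f : StructMap d A B}
    {cA : A →ₗ[F] (X → F)} {cB : B →ₗ[F] (X → F)} {p q : X → Prop} (h : Compat d f cA cB p q)
    (hA : IsCoord cA p) (hB : IsCoord cB q) (hf : StructMap.IsIso d f) :
    Compat d.rev (StructMap.inv d f hf) cA cB p q := by
  classical
  have hpq := h.iff_of_isIso hA hB hf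
  cases d
  · intro b x
    obtain ⟨a, rfl⟩ := (show Function.Bijective (show A →ₗ[F] B from f) from hf).2 b
    have h1 : (show B →ₗ[F] A from StructMap.inv Dir.fwd f hf) ((show A →ₗ[F] B from f) a) = a :=
      (LinearEquiv.ofBijective (show A →ₗ[F] B from f) hf).symm_apply_apply a
    refine (congrFun (congrArg cA h1) x).trans ?_
    rw [show cB ((show A →ₗ[F] B from f) a) x = _ from h a x]
    have := hA.supp a x
    have := hpq x
    grind
  · intro a x
    obtain ⟨b, rfl⟩ := (show Function.Bijective (show B →ₗ[F] A from f) from hf).2 a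
    have h1 : (show A →ₗ[F] B from StructMap.inv Dir.bwd f hf) ((show B →ₗ[F] A from f) b) = b :=
      (LinearEquiv.ofBijective (show B →ₗ[F] A from f) hf).symm_apply_apply b
    refine (congrFun (congrArg cB h1) x).trans ?_
    rw [show cA ((show B →ₗ[F] A from f) b) x = _ from h b x]
    have := hB.supp b x
    have := hpq x
    grind

/-- Transport of a coordinate map along an equality of spaces. -/
def coordCast {A A' : FGModuleCat.{u} F} (h : A = A') (c : A →ₗ[F] (X → F)) : A' →ₗ[F] (X → F) :=
  h ▸ c

theorem IsCoord.coordCast {A A' : FGModuleCat.{u} F} (h : A = A') {c : A →ₗ[F] (X → F)}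
    {p : X → Prop} (hc : IsCoord c p) : IsCoord (coordCast h c) p := by
  subst h; exact hc

theorem Compat.cast {d d' : Dir} {A A' B B' : FGModuleCat.{u} F} (hd : d = d') (hA : A = A')
    (hB : B = B') {f : StructMap d A B} {cA : A →ₗ[F] (X → F)} {cB : B →ₗ[F] (X → F)}
    {p q : X → Prop} (h : Compat d f cA cB p q) :
    Compat d' (StructMap.cast hd hA hB f) (coordCast hA cA) (coordCast hB cB) p q := by
  subst hd hA hB; exact h

/-! ### Local computation of limits and colimits -/

/-- The local support at the reflected vertex of a limit reflection: `dl`, `dr` are the directions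
of the adjacent arrows, and `pl`, `p`, `pr` say whether the interval contains the left neighbour,
the vertex itself, and the right neighbour. -/
def limSupp : Dir → Dir → Prop → Prop → Prop → Prop
  | .fwd, .fwd, pl, _, _ => pl
  | .bwd, .bwd, _, _, pr => pr
  | .bwd, .fwd, _, p, _ => p
  | .fwd, .bwd, pl, p, pr => (pl ∧ p ∧ pr) ∨ (¬ p ∧ (pl ∨ pr))

/-- The local support at the reflected vertex of a colimit reflection, with the conventions of
`limSupp`. -/
def colimSupp : Dir → Dir → Prop → Prop → Prop → Prop
  | .fwd, .fwd, _, _, pr => pr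
  | .bwd, .bwd, pl, _, _ => pl
  | .fwd, .bwd, _, p, _ => p
  | .bwd, .fwd, pl, p, pr => (pl ∧ p ∧ pr) ∨ (¬ p ∧ (pl ∨ pr))

section Reflection

variable {B : FGModuleCat.{u} F} {l : LeftArrow B} {r : RightArrow B}
  {cl : l.space →ₗ[F] (X → F)} {c : B →ₗ[F] (X → F)} {cr : r.space →ₗ[F] (X → F)}
  {pl p pr : X → Prop}

open Classical in
/-- Coordinates on the limit of `A ↔ B ↔ C`: the common value of those coordinates of a compatible
triple that exist. -/
noncomputable def limCoord (l : LeftArrow B) (r : RightArrow B) (cl : l.space →ₗ[F] (X → F))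
    (c : B →ₗ[F] (X → F)) (cr : r.space →ₗ[F] (X → F)) (pl p : X → Prop) :
    lim l r →ₗ[F] (X → F) :=
  LinearMap.pi fun x =>
    (if p x then LinearMap.proj x ∘ₗ c ∘ₗ LinearMap.fst F B r.space ∘ₗ
        LinearMap.snd F l.space (B × r.space)
      else if pl x then LinearMap.proj x ∘ₗ cl ∘ₗ LinearMap.fst F l.space (B × r.space)
      else LinearMap.proj x ∘ₗ cr ∘ₗ LinearMap.snd F B r.space ∘ₗ
        LinearMap.snd F l.space (B × r.space)) ∘ₗ (limSubmodule l r).subtype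

open Classical in
theorem limCoord_apply (t : lim l r) (x : X) : limCoord l r cl c cr pl p t x =
    if p x then c t.1.2.1 x else if pl x then cl t.1.1 x else cr t.1.2.2 x := by
  simp only [limCoord, LinearMap.pi_apply]
  split_ifs <;> rfl

open Classical in
/-- Membership in the graph of a structure map, in coordinates; see `mem_graph_iff`. -/
def graphCond : Dir → (X → Prop) → (X → Prop) → (X → F) → (X → F) → Prop
  | .fwd, _, q, f, g => ∀ x, g x = if q x then f x else 0
  | .bwd, p, _, f, g => ∀ x, f x = if p x then g x else 0

theorem mem_graph_iff {d : Dir} {A B : FGModuleCat.{u} F} {f : StructMap d A B}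
    {cA : A →ₗ[F] (X → F)} {cB : B →ₗ[F] (X → F)} {p q : X → Prop} (h : Compat d f cA cB p q)
    (hA : IsCoord cA p) (hB : IsCoord cB q) (a : A) (b : B) :
    (a, b) ∈ StructMap.graph d f ↔ graphCond d p q (cA a) (cB b) := by
  cases d
  · change (show A →ₗ[F] B from f) a = b ↔ _
    constructor
    · rintro rfl x
      exact h a x
    · intro hx
      exact hB.ext fun x => (h a x).trans (hx x).symm
  · change a = (show B →ₗ[F] A from f) b ↔ _
    constructor
    · rintro rfl x
      exact h b x
    · intro hx
      exact hA.ext fun x => (hx x).trans (h b x).symm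

theorem mem_limSubmodule_iff (hl : IsCoord cl pl) (hc : IsCoord c p) (hr : IsCoord cr pr)
    (hlc : Compat l.dir l.map cl c pl p) (hcr : Compat r.dir r.map c cr p pr)
    (t : l.space × B × r.space) : t ∈ limSubmodule l r ↔
      graphCond l.dir pl p (cl t.1) (c t.2.1) ∧ graphCond r.dir p pr (c t.2.1) (cr t.2.2) := by
  rw [← mem_graph_iff hlc hl hc, ← mem_graph_iff hcr hc hr]
  rfl

/-- The limit of an adapted diagram `A ↔ B ↔ C` is again adapted. The hypothesis `hp` says that no
interval contains both neighbours without the vertex in the middle; otherwise the middle vertex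
would have to be split into two intervals. -/
theorem limCoord_spec (hl : IsCoord cl pl) (hc : IsCoord c p) (hr : IsCoord cr pr)
    (hlc : Compat l.dir l.map cl c pl p) (hcr : Compat r.dir r.map c cr p pr)
    (hp : ∀ x, pl x → pr x → p x) :
    IsCoord (limCoord l r cl c cr pl p) (fun x => limSupp l.dir r.dir (pl x) (p x) (pr x)) ∧
    Compat .bwd (limToLeft l r) cl (limCoord l r cl c cr pl p) pl
      (fun x => limSupp l.dir r.dir (pl x) (p x) (pr x)) ∧
    Compat .fwd (limToRight l r) (limCoord l r cl c cr pl p) cr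
      (fun x => limSupp l.dir r.dir (pl x) (p x) (pr x)) pr := by
  classical
  have mem := mem_limSubmodule_iff hl hc hr hlc hcr
  have left : ∀ (t : lim l r) x, cl t.1.1 x =
      if pl x then limCoord l r cl c cr pl p t x else 0 := by
    intro t x
    obtain ⟨h1, h2⟩ := (mem t.1).1 t.2
    have e1 := hl.supp t.1.1 x
    have e2 := hc.supp t.1.2.1 x
    rw [limCoord_apply]
    cases hd : l.dir <;> rw [hd] at h1 <;> have := h1 x <;> grind
  have right : ∀ (t : lim l r) x, cr t.1.2.2 x =
      if pr x then limCoord l r cl c cr pl p t x else 0 := by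
    intro t x
    obtain ⟨h1, h2⟩ := (mem t.1).1 t.2
    have e1 := hr.supp t.1.2.2 x
    have e2 := hc.supp t.1.2.1 x
    have := hp x
    rw [limCoord_apply]
    cases hd : r.dir <;> rw [hd] at h2 <;> have := h2 x <;> grind
  refine ⟨⟨?_, ?_, ?_⟩, left, right⟩
  · intro t ht
    have hx := fun x => congrFun ht x
    apply Subtype.ext
    refine Prod.ext (hl.inj _ ?_) (Prod.ext (hc.inj _ ?_) (hr.inj _ ?_))
    · ext x; rw [left, hx]; simp
    · ext x
      have h3 := hx x
      have := hc.supp t.1.2.1 x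
      rw [limCoord_apply] at h3
      simp only [Pi.zero_apply] at *
      grind
    · ext x; rw [right, hx]; simp
  · intro t x hx
    obtain ⟨h1, h2⟩ := (mem t.1).1 t.2
    have e1 := hl.supp t.1.1 x
    have e2 := hc.supp t.1.2.1 x
    have e3 := hr.supp t.1.2.2 x
    have := hp x
    rw [limCoord_apply]
    cases hd : l.dir <;> cases hd' : r.dir <;> rw [hd] at h1 <;> rw [hd'] at h2 <;>
      rw [hd, hd'] at hx <;> simp only [limSupp, graphCond] at hx h1 h2 <;>
      have := h1 x <;> have := h2 x <;> grind
  · intro f hf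
    obtain ⟨a, ha⟩ := hl.surj (fun x => if pl x then f x else 0) (fun x hx => if_neg hx)
    obtain ⟨b, hb⟩ := hc.surj (fun x => if p x then f x else 0) (fun x hx => if_neg hx)
    obtain ⟨e, he⟩ := hr.surj (fun x => if pr x then f x else 0) (fun x hx => if_neg hx)
    have hm : (a, b, e) ∈ limSubmodule l r := by
      rw [mem]
      dsimp only
      rw [ha, hb, he]
      cases hd : l.dir <;> cases hd' : r.dir <;> rw [hd, hd'] at hf <;>
        simp only [limSupp, graphCond] at hf ⊢ <;>
        refine ⟨fun x => ?_, fun x => ?_⟩ <;> have := hf x <;> have := hp x <;> grind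
    refine ⟨⟨_, hm⟩, ?_⟩
    ext x
    refine (limCoord_apply (show lim l r from ⟨_, hm⟩) x).trans ?_
    dsimp only
    rw [ha, hb, he]
    dsimp only
    have := hp x
    have := hf x
    cases hd : l.dir <;> cases hd' : r.dir <;> rw [hd, hd'] at this <;>
        simp only [limSupp] at this ⊢ <;> grind

/-- Relations and graph differ by a sign, so that the colimit can be computed with `graphCond`
too. -/
theorem mem_relations_iff {d : Dir} {A B : FGModuleCat.{u} F} {f : StructMap d A B} (a : A)
    (b : B) : (a, b) ∈ StructMap.relations d f ↔ (a, -b) ∈ StructMap.graph d f := by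
  cases d
  · change (∃ y : A, (y, -(show A →ₗ[F] B from f) y) = (a, b)) ↔ (show A →ₗ[F] B from f) a = -b
    constructor
    · rintro ⟨y, hy⟩
      obtain ⟨rfl, rfl⟩ := Prod.ext_iff.1 hy
      simp
    · intro h
      exact ⟨a, by rw [h, neg_neg]⟩
  · change (∃ y : B, (-(show B →ₗ[F] A from f) y, y) = (a, b)) ↔ a = (show B →ₗ[F] A from f) (-b)
    constructor
    · rintro ⟨y, hy⟩
      obtain ⟨rfl, rfl⟩ := Prod.ext_iff.1 hy
      exact (map_neg (show B →ₗ[F] A from f) y).symm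
    · intro h
      exact ⟨b, by rw [h, map_neg]⟩

/-- A triple vanishes in the colimit if its middle entry splits into `b`, which cancels the left
entry, and a rest, which cancels the right one. -/
theorem mem_colimSubmodule_iff (t : l.space × B × r.space) : t ∈ colimSubmodule l r ↔
    ∃ b : B, (t.1, -b) ∈ StructMap.graph l.dir l.map ∧
      (t.2.1 - b, -t.2.2) ∈ StructMap.graph r.dir r.map := by
  simp only [← mem_relations_iff, colimSubmodule, Submodule.mem_sup, Submodule.mem_map]
  constructor
  · rintro ⟨_, ⟨⟨a, b⟩, h1, rfl⟩, _, ⟨⟨b', e⟩, h2, rfl⟩, rfl⟩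
    refine ⟨b, ?_, ?_⟩ <;> simpa
  · rintro ⟨b, h1, h2⟩
    refine ⟨_, ⟨_, h1, rfl⟩, _, ⟨_, h2, rfl⟩, ?_⟩
    simp

open Classical in
/-- The colimit of an adapted diagram `A ↔ B ↔ C` is again adapted. -/
theorem colimCoord_spec (hl : IsCoord cl pl) (hc : IsCoord c p) (hr : IsCoord cr pr)
    (hlc : Compat l.dir l.map cl c pl p) (hcr : Compat r.dir r.map c cr p pr)
    (hp : ∀ x, pl x → pr x → p x) : ∃ cC : colim l r →ₗ[F] (X → F),
    IsCoord cC (fun x => colimSupp l.dir r.dir (pl x) (p x) (pr x)) ∧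
    Compat .fwd (leftToColim l r) cl cC pl
      (fun x => colimSupp l.dir r.dir (pl x) (p x) (pr x)) ∧
    Compat .bwd (rightToColim l r) cC cr
      (fun x => colimSupp l.dir r.dir (pl x) (p x) (pr x)) pr := by
  have mem : ∀ t : l.space × B × r.space, t ∈ colimSubmodule l r ↔ ∃ b : B,
      graphCond l.dir pl p (cl t.1) (c (-b)) ∧
      graphCond r.dir p pr (c (t.2.1 - b)) (cr (-t.2.2)) := fun t => by
    simp only [mem_colimSubmodule_iff, mem_graph_iff hlc hl hc, mem_graph_iff hcr hc hr]
  -- The coordinate of a class is the sum of the three coordinates of a representative.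
  let g : l.space × B × r.space →ₗ[F] (X → F) := LinearMap.pi fun x =>
    if colimSupp l.dir r.dir (pl x) (p x) (pr x) then
      LinearMap.proj x ∘ₗ (cl.coprod (c.coprod cr)) else 0
  have hg : ∀ t x, g t x = if colimSupp l.dir r.dir (pl x) (p x) (pr x) then
      cl t.1 x + (c t.2.1 x + cr t.2.2 x) else 0 := by
    intro t x
    simp only [g, LinearMap.pi_apply]
    split_ifs <;> simp
  have hker : colimSubmodule l r ≤ LinearMap.ker g := by
    intro t ht
    obtain ⟨b, h1, h2⟩ := (mem t).1 ht
    rw [LinearMap.mem_ker]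
    ext x
    rw [hg]
    have e1 := hl.supp t.1 x
    have e2 := hc.supp t.2.1 x
    have e3 := hr.supp t.2.2 x
    have e4 := hc.supp b x
    have e5 := hp x
    have n1 : c (-b) x = -(c b x) := by simp
    have n2 : c (t.2.1 - b) x = c t.2.1 x - c b x := by simp
    have n3 : cr (-t.2.2) x = -(cr t.2.2 x) := by simp
    change _ = (0 : F)
    cases hd : l.dir <;> cases hd' : r.dir <;> rw [hd] at h1 <;> rw [hd'] at h2 <;>
      simp only [colimSupp, graphCond] at h1 h2 ⊢ <;>
      have h1 := h1 x <;> have h2 := h2 x <;> simp only [n1, n2, n3] at h1 h2 <;>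
      clear n1 n2 n3 <;> clear hg g mem ht <;> grind
  refine ⟨(colimSubmodule l r).liftQ g hker, ⟨?_, ?_, ?_⟩, ?_, ?_⟩
  · intro q hq
    obtain ⟨t, rfl⟩ := (colimSubmodule l r).mkQ_surjective q
    refine (Submodule.Quotient.mk_eq_zero _).2 ((mem t).2 ?_)
    have hx : ∀ x, g t x = 0 := fun x => congrFun hq x
    -- The three coordinates cancel; `h` is the part of the middle one which cancels the left one.
    let h : X → F := fun x => match l.dir, r.dir with
      | .fwd, _ => if p x then -cl t.1 x else 0
      | .bwd, .bwd => c t.2.1 x + if p x then cr t.2.2 x else 0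
      | .bwd, .fwd => if p x then (if pl x then -cl t.1 x else
          if pr x then c t.2.1 x + cr t.2.2 x else 0) else 0
    obtain ⟨b, hb⟩ := hc.surj h (fun x hx => by
      have := hc.supp t.2.1 x hx
      simp only [h]
      split <;> simp [hx, this])
    refine ⟨b, ?_⟩
    have key : ∀ x, c b x = h x := fun x => congrFun hb x
    simp only [h] at key
    cases hd : l.dir <;> cases hd' : r.dir <;> refine ⟨fun x => ?_, fun x => ?_⟩ <;>
      have e0 := hx x <;> have e1 := hl.supp t.1 x <;> have e2 := hc.supp t.2.1 x <;>
      have e3 := hr.supp t.2.2 x <;> have e4 := key x <;> have e5 := hp x <;>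
      rw [hg] at e0 <;> simp only [hd, hd', colimSupp, map_neg, map_sub] at e0 e4 ⊢ <;>
      [change -(c b x) = _; change -(cr t.2.2 x) = if pr x then c t.2.1 x - c b x else 0;
       change -(c b x) = _; change c t.2.1 x - c b x = if p x then -(cr t.2.2 x) else 0;
       change _ = if pl x then -(c b x) else 0;
       change -(cr t.2.2 x) = if pr x then c t.2.1 x - c b x else 0;
       change _ = if pl x then -(c b x) else 0;
       change c t.2.1 x - c b x = if p x then -(cr t.2.2 x) else 0] <;>
      clear hx key mem hb h hq <;> clear hker hg <;> clear g <;> grind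
  · intro q x hx
    obtain ⟨t, rfl⟩ := (colimSubmodule l r).mkQ_surjective q
    exact (hg t x).trans (if_neg hx)
  · intro f hf
    obtain ⟨a, ha⟩ := hl.surj (fun x => if pl x then f x else 0) (fun x hx => if_neg hx)
    obtain ⟨b, hb⟩ := hc.surj (fun x => if p x then (if pl x then 0 else f x) else 0)
      (fun x hx => if_neg hx)
    obtain ⟨e, he⟩ := hr.surj (fun x => if pr x then (if pl x ∨ p x then 0 else f x) else 0)
      (fun x hx => if_neg hx)
    refine ⟨(colimSubmodule l r).mkQ (a, b, e), ?_⟩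
    ext x
    refine (hg (a, b, e) x).trans ?_
    simp only [ha, hb, he]
    have := hf x
    cases hd : l.dir <;> cases hd' : r.dir <;> rw [hd, hd'] at this <;>
      simp only [colimSupp] at this ⊢ <;> grind
  · intro a x
    refine (hg (a, 0, 0) x).trans ?_
    simp
  · intro e x
    refine (hg (0, 0, e) x).trans ?_
    simp

end Reflection

/-! ### Decompositions with prescribed supports -/

/-- The coordinate maps `c i` identify `V` with the direct sum, over `x : X`, of the modules which
have one copy of `F` at each vertex in `s x`. The supports `s x` may be empty, which makes it
possible to follow a fixed index set through a sequence of reflections. -/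
structure IsAdapted (V : TauMod F τ) (s : X → Set (Fin n))
    (c : ∀ i, V.space i →ₗ[F] (X → F)) : Prop where
  coord : ∀ i, IsCoord (c i) (fun x => i ∈ s x)
  compat : ∀ i, Compat (τ i) (V.map i) (c (lo i)) (c (hi i)) (fun x => lo i ∈ s x)
    (fun x => hi i ∈ s x)

/-- `V` decomposes into modules supported on the sets `s x`. -/
def Decomp (V : TauMod F τ) (s : X → Set (Fin n)) : Prop := ∃ c, IsAdapted V s c

theorem Decomp.of_iso {V W : TauMod F τ} {s : X → Set (Fin n)} (h : Decomp V s) (e : V.Iso W) :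
    Decomp W s := by
  obtain ⟨c, hc⟩ := h
  obtain ⟨e, he⟩ := e
  refine ⟨fun i => c i ∘ₗ (e i).symm.toLinearMap, fun i => ⟨fun a ha => ?_, fun a x hx => ?_,
    fun f hf => ?_⟩, fun i => ?_⟩
  · exact (e i).symm.map_eq_zero_iff.1 ((hc.coord i).inj _ ha)
  · exact (hc.coord i).supp _ _ hx
  · obtain ⟨a, rfl⟩ := (hc.coord i).surj f hf
    exact ⟨e i a, by simp⟩
  · have h1 := hc.compat i
    have h2 := he i
    generalize V.map i = f at h1 h2
    generalize W.map i = g at h2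
    generalize τ i = d at *
    cases d
    · intro a x
      obtain ⟨a, rfl⟩ := (e (lo i)).surjective a
      have h3 : e (hi i) ((show V.space (lo i) →ₗ[F] V.space (hi i) from f) a) =
        (show W.space (lo i) →ₗ[F] W.space (hi i) from g) (e (lo i) a) := LinearMap.congr_fun h2 a
      have := h1 a x
      simp only [LinearMap.comp_apply, LinearEquiv.coe_coe, LinearEquiv.symm_apply_apply]
      rw [← this]
      exact congrFun (congrArg (c _) ((e (hi i)).symm_apply_eq.2 h3.symm)) x
    · intro a x
      obtain ⟨a, rfl⟩ := (e (hi i)).surjective a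
      have h3 : e (lo i) ((show V.space (hi i) →ₗ[F] V.space (lo i) from f) a) =
        (show W.space (hi i) →ₗ[F] W.space (lo i) from g) (e (hi i) a) := LinearMap.congr_fun h2 a
      have := h1 a x
      simp only [LinearMap.comp_apply, LinearEquiv.coe_coe, LinearEquiv.symm_apply_apply]
      rw [← this]
      exact congrFun (congrArg (c _) ((e (lo i)).symm_apply_eq.2 h3.symm)) x

/-- The supports determine the module up to isomorphism. -/
theorem Decomp.iso {V W : TauMod F τ} {s : X → Set (Fin n)} (h : Decomp V s) (h' : Decomp W s) :
    V.Iso W := by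
  obtain ⟨c, hc⟩ := h
  obtain ⟨c', hc'⟩ := h'
  have : ∀ i, ∃ e : V.space i ≃ₗ[F] W.space i, ∀ a, c' i (e a) = c i a := by
    intro i
    have h1 : Function.Injective (c i) :=
      (injective_iff_map_eq_zero _).2 fun a => (hc.coord i).inj a
    have h2 : Function.Injective (c' i) :=
      (injective_iff_map_eq_zero _).2 fun a => (hc'.coord i).inj a
    have h3 : LinearMap.range (c i) = LinearMap.range (c' i) := by
      apply le_antisymm
      · rintro _ ⟨a, rfl⟩
        exact (hc'.coord i).surj _ fun x hx => (hc.coord i).supp _ _ hx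
      · rintro _ ⟨a, rfl⟩
        exact (hc.coord i).surj _ fun x hx => (hc'.coord i).supp _ _ hx
    refine ⟨(LinearEquiv.ofInjective _ h1).trans ((LinearEquiv.ofEq _ _ h3).trans
      (LinearEquiv.ofInjective _ h2).symm), fun a => ?_⟩
    exact congrArg Subtype.val (LinearEquiv.apply_symm_apply (LinearEquiv.ofInjective (c' i) h2)
      (LinearEquiv.ofEq _ _ h3 (LinearEquiv.ofInjective _ h1 a)))
  choose e he using this
  refine ⟨e, fun i => ?_⟩
  have h1 := hc.compat i
  have h2 := hc'.compat i
  generalize V.map i = f at h1 ⊢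
  generalize W.map i = g at h2 ⊢
  generalize τ i = d at *
  cases d
  · refine LinearMap.ext fun a => (hc'.coord _).ext fun x => ?_
    refine (congrFun (he _ _) x).trans ?_
    refine (h1 a x).trans ((h2 (e _ a) x).trans ?_).symm
    rw [he]
  · refine LinearMap.ext fun a => (hc'.coord _).ext fun x => ?_
    refine (congrFun (he _ _) x).trans ?_
    refine (h1 a x).trans ((h2 (e _ a) x).trans ?_).symm
    rw [he]

/-- Empty supports can be added and removed. -/
theorem Decomp.reindex {V : TauMod F τ} {s : X → Set (Fin n)} {t : Y → Set (Fin n)}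
    (h : Decomp V s) (e : {x // (s x).Nonempty} ≃ {y // (t y).Nonempty})
    (he : ∀ x, t (e x) = s x) : Decomp V t := by
  classical
  obtain ⟨c, hc⟩ := h
  have he' : ∀ y, s (e.symm y) = t y := fun y => by rw [← he, e.apply_symm_apply]
  let c' : ∀ i, V.space i →ₗ[F] (Y → F) := fun i => LinearMap.pi fun y =>
    if hy : (t y).Nonempty then LinearMap.proj (e.symm ⟨y, hy⟩).1 ∘ₗ c i else 0
  have hc'1 : ∀ i a (y : {y // (t y).Nonempty}), c' i a y = c i a (e.symm y) := by
    intro i a y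
    simp only [c', LinearMap.pi_apply, y.2, dif_pos]
    rfl
  have hc'2 : ∀ i a y, ¬ (t y).Nonempty → c' i a y = 0 := by
    intro i a y hy
    simp [c', hy]
  refine ⟨c', fun i => ⟨fun a ha => ?_, fun a y hy => ?_, fun f hf => ?_⟩, fun i => ?_⟩
  · apply (hc.coord i).inj
    ext x
    by_cases hx : (s x).Nonempty
    · have := hc'1 i a (e ⟨x, hx⟩)
      rw [e.symm_apply_apply, ha] at this
      exact this.symm
    · exact (hc.coord i).supp a x fun hi => hx ⟨_, hi⟩
  · by_cases hy' : (t y).Nonempty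
    · rw [hc'1 i a ⟨y, hy'⟩]
      exact (hc.coord i).supp _ _ (by rwa [he'])
    · exact hc'2 i a y hy'
  · obtain ⟨a, ha⟩ := (hc.coord i).surj
      (fun x => if hx : (s x).Nonempty then f (e ⟨x, hx⟩) else 0) fun x hx => by
        split_ifs with h
        · exact hf _ (by rwa [he])
        · rfl
    refine ⟨a, ?_⟩
    ext y
    by_cases hy : (t y).Nonempty
    · rw [hc'1 i a ⟨y, hy⟩, ha]
      simp [(e.symm ⟨y, hy⟩).2]
    · rw [hc'2 i a y hy, hf y fun hi => hy ⟨_, hi⟩]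
  · have h1 := hc.compat i
    generalize V.map i = f at h1 ⊢
    generalize τ i = d at *
    cases d
    · intro a y
      by_cases hy : (t y).Nonempty
      · rw [hc'1 _ _ ⟨y, hy⟩, hc'1 _ _ ⟨y, hy⟩]
        refine (h1 a _).trans ?_
        simp only [he']
      · rw [hc'2 _ _ _ hy, hc'2 _ _ _ hy, ite_self]
    · intro a y
      by_cases hy : (t y).Nonempty
      · rw [hc'1 _ _ ⟨y, hy⟩, hc'1 _ _ ⟨y, hy⟩]
        refine (h1 a _).trans ?_
        simp only [he']
      · rw [hc'2 _ _ _ hy, hc'2 _ _ _ hy, ite_self]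

theorem Decomp.sum {V W : TauMod F τ} {s : X → Set (Fin n)} {t : Y → Set (Fin n)}
    (h : Decomp V s) (h' : Decomp W t) : Decomp (V.sum W) (Sum.elim s t) := by
  obtain ⟨c, hc⟩ := h
  obtain ⟨c', hc'⟩ := h'
  let g : ∀ i, (V.space i × W.space i) →ₗ[F] (X ⊕ Y → F) := fun i => LinearMap.pi fun z =>
    Sum.elim (fun x => LinearMap.proj x ∘ₗ c i ∘ₗ LinearMap.fst F _ _)
      (fun y => LinearMap.proj y ∘ₗ c' i ∘ₗ LinearMap.snd F _ _) z
  refine ⟨g, fun i => ⟨fun a ha => ?_, fun a z hz => ?_, fun f hf => ?_⟩, fun i => ?_⟩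
  · refine Prod.ext ((hc.coord i).inj _ ?_) ((hc'.coord i).inj _ ?_)
    · ext x
      exact congrFun ha (Sum.inl x)
    · ext y
      exact congrFun ha (Sum.inr y)
  · cases z with
    | inl x => exact (hc.coord i).supp a.1 x hz
    | inr y => exact (hc'.coord i).supp a.2 y hz
  · obtain ⟨a, ha⟩ := (hc.coord i).surj (fun x => f (Sum.inl x)) fun x hx => hf (Sum.inl x) hx
    obtain ⟨b, hb⟩ := (hc'.coord i).surj (fun x => f (Sum.inr x)) fun x hx => hf (Sum.inr x) hx
    refine ⟨(a, b), ?_⟩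
    ext z
    cases z with
    | inl x => exact congrFun ha x
    | inr y => exact congrFun hb y
  · have h1 := hc.compat i
    have h2 := hc'.compat i
    change Compat (τ i) (StructMap.prod (τ i) (V.map i) (W.map i)) _ _ _ _
    generalize V.map i = f at h1 ⊢
    generalize W.map i = f' at h2 ⊢
    generalize τ i = d at *
    cases d
    · rintro a (x | y)
      · exact h1 a.1 x
      · exact h2 a.2 y
    · rintro a (x | y)
      · exact h1 a.1 x
      · exact h2 a.2 y

theorem decomp_intervalSum (τ : ZType n) (D : Multiset (Fin n × Fin n)) :
    Decomp (intervalSum F τ D) (fun x : D.ToType => Set.Icc x.1.1 x.1.2) := by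
  classical
  let c : ∀ i, (∀ x : D.ToType, PLift (x.1.1 ≤ i ∧ i ≤ x.1.2) → F) →ₗ[F] (D.ToType → F) :=
    fun i => LinearMap.pi fun x => if h : x.1.1 ≤ i ∧ i ≤ x.1.2 then
      LinearMap.proj (PLift.up h) ∘ₗ LinearMap.proj x else 0
  have hc1 : ∀ i a (x : D.ToType) (h : x.1.1 ≤ i ∧ i ≤ x.1.2), c i a x = a x ⟨h⟩ := by
    intro i a x h
    simp only [c, LinearMap.pi_apply, h, dif_pos, and_self]
    rfl
  have hc2 : ∀ i a (x : D.ToType), ¬ (x.1.1 ≤ i ∧ i ≤ x.1.2) → c i a x = 0 := by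
    intro i a x h
    simp only [c, LinearMap.pi_apply, h, dif_neg, not_false_eq_true, LinearMap.zero_apply]
  have key : ∀ i j (a : ∀ x : D.ToType, PLift (x.1.1 ≤ i ∧ i ≤ x.1.2) → F) (x : D.ToType),
      c j (fun x => intervalMap F x.1.1 x.1.2 i j (a x)) x =
        if j ∈ Set.Icc x.1.1 x.1.2 then c i a x else 0 := by
    intro i j a x
    split_ifs with h
    · refine (hc1 j _ x h).trans ?_
      by_cases h' : x.1.1 ≤ i ∧ i ≤ x.1.2
      · rw [hc1 _ _ _ h']
        change (if h : x.1.1 ≤ i ∧ i ≤ x.1.2 then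
          (LinearMap.proj (PLift.up h) : (PLift (x.1.1 ≤ i ∧ i ≤ x.1.2) → F) →ₗ[F] F)
          else 0) (a x) = _
        rw [dif_pos h']
        rfl
      · rw [hc2 _ _ _ h']
        change (if h : x.1.1 ≤ i ∧ i ≤ x.1.2 then
          (LinearMap.proj (PLift.up h) : (PLift (x.1.1 ≤ i ∧ i ≤ x.1.2) → F) →ₗ[F] F)
          else 0) (a x) = _
        rw [dif_neg h']
        rfl
    · exact hc2 _ _ _ h
  refine ⟨c, fun i => ⟨fun a ha => ?_, fun a x hx => hc2 i a x hx, fun f hf => ?_⟩, fun i => ?_⟩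
  · funext x h
    exact (hc1 i a x h.down).symm.trans (congrFun ha x)
  · refine ⟨fun x _ => f x, ?_⟩
    ext x
    by_cases hx : x.1.1 ≤ i ∧ i ≤ x.1.2
    · exact hc1 i _ x hx
    · exact (hc2 i _ x hx).trans (hf x hx).symm
  · change Compat (τ i) (StructMap.pi (τ i) fun x : D.ToType =>
      (interval F τ x.1.1 x.1.2).map i) _ _ _ _
    have hm : ∀ x : D.ToType, (interval F τ x.1.1 x.1.2).map i = (match τ i with
      | .fwd => intervalMap F x.1.1 x.1.2 (lo i) (hi i)
      | .bwd => intervalMap F x.1.1 x.1.2 (hi i) (lo i) :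
        StructMap (τ i) (intervalSpace F x.1.1 x.1.2 (lo i))
          (intervalSpace F x.1.1 x.1.2 (hi i))) := fun x => rfl
    simp only [hm]
    change Compat (τ i) (StructMap.pi (A := fun x : D.ToType => intervalSpace F x.1.1 x.1.2 (lo i))
      (B := fun x : D.ToType => intervalSpace F x.1.1 x.1.2 (hi i)) (τ i) _) _ _ _ _
    generalize τ i = d
    cases d
    · intro a x
      exact (key (lo i) (hi i) a x).trans (by congr)
    · intro a x
      exact (key (hi i) (lo i) a x).trans (by congr)

theorem Decomp.reverse {V : TauMod F τ} {s : X → Set (Fin n)} (h : Decomp V s) (k : Fin (n - 1))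
    (hk : StructMap.IsIso (τ k) (V.map k)) : Decomp (V.reverse k hk) s := by
  obtain ⟨c, hc⟩ := h
  refine ⟨c, hc.coord, fun i => ?_⟩
  simp only [TauMod.reverse]
  split_ifs with h
  · exact Compat.cast _ rfl rfl ((hc.compat i).inv (hc.coord _) (hc.coord _) _)
  · exact Compat.cast _ rfl rfl (hc.compat i)

theorem Decomp.of_equivalent {V W : NMod F n} (h : Equivalent V W) {s : X → Set (Fin n)}
    (hs : Decomp V.2 s) : Decomp W.2 s := by
  induction h with
  | of_iso e => exact hs.of_iso e
  | of_reverse V k hk _ ih => exact ih (hs.reverse k hk)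

/-! ### Reflections of decompositions -/

/-- The left neighbour of `k` exists and lies in `s`. -/
def leftMem (k : Fin n) (s : Set (Fin n)) : Prop := ∃ j ∈ s, j.1 + 1 = k.1

/-- The right neighbour of `k` exists and lies in `s`. -/
def rightMem (k : Fin n) (s : Set (Fin n)) : Prop := ∃ j ∈ s, j.1 = k.1 + 1

/-- The arrow to the left of `k` is adapted. At the first vertex it starts at the zero space, whose
coordinates vanish and lie in no interval. -/
theorem exists_leftCoord {V : TauMod F τ} {s : X → Set (Fin n)}
    {c : ∀ i, V.space i →ₗ[F] (X → F)} (hc : IsAdapted V s c) (d₀ : Dir) (k : Fin n) :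
    ∃ cl : (V.leftArrow d₀ k).space →ₗ[F] (X → F),
      IsCoord cl (fun x => leftMem k (s x)) ∧
      Compat (V.leftArrow d₀ k).dir (V.leftArrow d₀ k).map cl (c k) (fun x => leftMem k (s x))
        (fun x => k ∈ s x) ∧
      ∀ i (h : V.space (lo i) = (V.leftArrow d₀ k).space), hi i = k →
        cl = coordCast h (c (lo i)) := by
  obtain ⟨k, hk⟩ := k
  cases k with
  | zero =>
    refine ⟨0, ⟨fun a _ => Subsingleton.elim (α := PUnit) _ _, fun _ _ _ => rfl, fun f hf =>
      ⟨0, ?_⟩⟩, ?_, ?_⟩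
    · ext x
      exact (hf x (by rintro ⟨j, _, h⟩; simp at h)).symm
    · change Compat d₀ (StructMap.zero d₀ _ _) _ _ _ _
      cases d₀
      · intro a x
        change c _ 0 x = _
        simp
      · intro a x
        have : ¬ leftMem (⟨0, hk⟩ : Fin n) (s x) := by rintro ⟨j, _, h⟩; simp at h
        change (0 : F) = _
        rw [if_neg this]
    · intro i _ hi'
      simp [hi] at hi'
  | succ j =>
    have hm : ∀ x, leftMem ⟨j + 1, hk⟩ (s x) ↔ lo ⟨j, by omega⟩ ∈ s x := by
      intro x
      constructor
      · rintro ⟨i, hi, h⟩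
        simp only [Nat.add_right_cancel_iff] at h
        subst h
        exact hi
      · intro h
        exact ⟨_, h, rfl⟩
    refine ⟨c (lo ⟨j, by omega⟩), ?_, ?_, ?_⟩
    · simp only [hm]
      exact hc.coord _
    · simp only [hm]
      exact hc.compat ⟨j, by omega⟩
    · intro i h hi'
      obtain ⟨i, hi''⟩ := i
      simp only [hi, Fin.mk.injEq, Nat.add_right_cancel_iff] at hi'
      subst hi'
      rfl

theorem exists_rightCoord {V : TauMod F τ} {s : X → Set (Fin n)}
    {c : ∀ i, V.space i →ₗ[F] (X → F)} (hc : IsAdapted V s c) (d₀ : Dir) (k : Fin n) :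
    ∃ cr : (V.rightArrow d₀ k).space →ₗ[F] (X → F),
      IsCoord cr (fun x => rightMem k (s x)) ∧
      Compat (V.rightArrow d₀ k).dir (V.rightArrow d₀ k).map (c k) cr (fun x => k ∈ s x)
        (fun x => rightMem k (s x)) ∧
      ∀ i (h : V.space (hi i) = (V.rightArrow d₀ k).space), lo i = k →
        cr = coordCast h (c (hi i)) := by
  by_cases hk : k.1 < n - 1
  · obtain ⟨i, rfl⟩ : ∃ i, lo i = k := ⟨⟨k.1, hk⟩, rfl⟩
    have hm : ∀ x, rightMem (lo i) (s x) ↔ hi i ∈ s x := by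
      intro x
      constructor
      · rintro ⟨j, hj, h⟩
        have : j = hi i := Fin.ext h
        exact this ▸ hj
      · intro h
        exact ⟨_, h, rfl⟩
    have hr : V.rightArrow d₀ (lo i) = ⟨V.space (hi i), τ i, V.map i⟩ := dif_pos hk
    rw [hr]
    refine ⟨c (hi i), ?_, ?_, ?_⟩
    · simp only [hm]
      exact hc.coord _
    · simp only [hm]
      exact hc.compat i
    · intro j h hj
      have : j = i := Fin.ext (by simpa [lo] using hj)
      subst this
      rfl
  · have hr : V.rightArrow d₀ k = ⟨FGModuleCat.of F PUnit.{u + 1}, d₀, StructMap.zero d₀ _ _⟩ :=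
      dif_neg hk
    have hm : ∀ x, ¬ rightMem k (s x) := by
      rintro x ⟨j, _, h⟩
      have := j.2
      omega
    rw [hr]
    refine ⟨0, ⟨fun a _ => Subsingleton.elim (α := PUnit) _ _, fun _ _ _ => rfl, fun f hf =>
      ⟨0, ?_⟩⟩, ?_, ?_⟩
    · ext x
      exact (hf x (hm x)).symm
    · cases d₀
      · intro a x
        rw [if_neg (hm x)]
        rfl
      · intro a x
        change c _ 0 x = _
        simp
    · intro i _ hi'
      have := i.2
      subst hi'
      exact absurd this hk

/-- Changing a support at a single vertex. -/
def updateSupp (k : Fin n) (p : Prop) (s : Set (Fin n)) : Set (Fin n) :=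
  {i | (i = k ∧ p) ∨ (i ≠ k ∧ i ∈ s)}

theorem mem_updateSupp_self {k : Fin n} {p : Prop} {s : Set (Fin n)} :
    k ∈ updateSupp k p s ↔ p := by
  simp [updateSupp]

theorem mem_updateSupp_of_ne {i k : Fin n} {p : Prop} {s : Set (Fin n)} (h : i ≠ k) :
    i ∈ updateSupp k p s ↔ i ∈ s := by
  simp [updateSupp, h]

theorem Decomp.replace {V : TauMod F τ} {s : X → Set (Fin n)}
    {c : ∀ i, V.space i →ₗ[F] (X → F)} (hc : IsAdapted V s c) {d₀ dl dr : Dir} {k : Fin n}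
    {cl : (V.leftArrow d₀ k).space →ₗ[F] (X → F)} {cr : (V.rightArrow d₀ k).space →ₗ[F] (X → F)}
    (hcl : ∀ i (h : V.space (lo i) = (V.leftArrow d₀ k).space), hi i = k →
        cl = coordCast h (c (lo i)))
    (hcr : ∀ i (h : V.space (hi i) = (V.rightArrow d₀ k).space), lo i = k →
        cr = coordCast h (c (hi i)))
    {L : FGModuleCat.{u} F} {f : StructMap dl (V.leftArrow d₀ k).space L}
    {g : StructMap dr L (V.rightArrow d₀ k).space} {cL : L →ₗ[F] (X → F)} {p : X → Prop}
    (hL : IsCoord cL p)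
    (hf : Compat dl f cl cL (fun x => leftMem k (s x)) p)
    (hg : Compat dr g cL cr p (fun x => rightMem k (s x))) :
    Decomp (V.replace k dl dr d₀ L f g) (fun x => updateSupp k (p x) (s x)) := by
  let c' : ∀ i, (Function.update V.space k L i : FGModuleCat.{u} F) →ₗ[F] (X → F) := fun i =>
    if h : i = k then coordCast (by rw [h, Function.update_self]) cL
    else coordCast (by rw [Function.update_of_ne h]) (c i)
  have hc1 : ∀ i (h : i = k), c' i = coordCast (by rw [h, Function.update_self]) cL :=
    fun i h => dif_pos h
  have hc2 : ∀ i (h : i ≠ k), c' i = coordCast (by rw [Function.update_of_ne h]) (c i) :=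
    fun i h => dif_neg h
  have cc : ∀ {A B C : FGModuleCat.{u} F} (h : A = B) (h' : B = C) (h'' : A = C)
      (c : A →ₗ[F] (X → F)), coordCast h'' c = coordCast h' (coordCast h c) := by
    intro A B C h h' h'' c
    subst h h'
    rfl
  refine ⟨c', fun i => ?_, fun i => ?_⟩
  · change IsCoord (c' i) _
    by_cases h : i = k
    · subst h
      simp only [mem_updateSupp_self]
      rw [hc1 i rfl]
      exact hL.coordCast _
    · simp only [mem_updateSupp_of_ne h]
      rw [hc2 i h]
      exact (hc.coord i).coordCast _
  · have hne : lo i ≠ hi i := by simp [lo, hi, Fin.ext_iff]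
    change Compat _ _ (c' (lo i)) (c' (hi i)) _ _
    simp only [TauMod.replace]
    split_ifs with h h'
    · have hA : V.space (lo i) = (V.leftArrow d₀ k).space := by
        subst h
        rfl
      have hlo : ∀ x, leftMem k (s x) ↔ lo i ∈ s x := by
        subst h
        intro x
        constructor
        · rintro ⟨j, hj, e⟩
          have : j = lo i := Fin.ext (Nat.add_right_cancel e)
          exact this ▸ hj
        · intro h
          exact ⟨_, h, rfl⟩
      have hne' : lo i ≠ k := h ▸ hne
      simp only [mem_updateSupp_of_ne hne', h, mem_updateSupp_self]
      rw [hc2 _ hne', hc1 _ h, cc hA _ _ (c (lo i)), ← hcl i hA h]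
      · simp only [hlo] at hf
        exact Compat.cast _ _ _ hf
    · have hA : V.space (hi i) = (V.rightArrow d₀ k).space := by
        subst h'
        rw [TauMod.rightArrow_lo]
      have hhi : ∀ x, rightMem k (s x) ↔ hi i ∈ s x := by
        subst h'
        intro x
        constructor
        · rintro ⟨j, hj, e⟩
          have : j = hi i := Fin.ext e
          exact this ▸ hj
        · intro h
          exact ⟨_, h, rfl⟩
      simp only [mem_updateSupp_of_ne h, h', mem_updateSupp_self]
      rw [hc2 _ h, hc1 _ h', cc hA _ _ (c (hi i)), ← hcr i hA h']
      · simp only [hhi] at hg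
        exact Compat.cast _ _ _ hg
    · simp only [mem_updateSupp_of_ne h, mem_updateSupp_of_ne h']
      rw [hc2 _ h, hc2 _ h']
      exact Compat.cast _ _ _ (hc.compat i)

theorem between_of_ordConnected {k : Fin n} {s : Set (Fin n)} (hs : s.OrdConnected)
    (h1 : leftMem k s) (h2 : rightMem k s) : k ∈ s := by
  obtain ⟨i, hi, e⟩ := h1
  obtain ⟨j, hj, e'⟩ := h2
  exact hs.out hi hj ⟨by rw [Fin.le_def]; omega, by rw [Fin.le_def]; omega⟩

theorem Decomp.extrovert {V : TauMod F τ} {s : X → Set (Fin n)} (h : Decomp V s)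
    (hs : ∀ x, (s x).OrdConnected) (k : Fin n) (d₀ : Dir) :
    Decomp (V.extrovert k d₀) (fun x => updateSupp k (limSupp (V.leftArrow d₀ k).dir
      (V.rightArrow d₀ k).dir (leftMem k (s x)) (k ∈ s x) (rightMem k (s x))) (s x)) := by
  obtain ⟨c, hc⟩ := h
  obtain ⟨cl, h1, h2, h3⟩ := exists_leftCoord hc d₀ k
  obtain ⟨cr, h4, h5, h6⟩ := exists_rightCoord hc d₀ k
  obtain ⟨h7, h8, h9⟩ := limCoord_spec h1 (hc.coord k) h4 h2 h5
    fun x => between_of_ordConnected (hs x)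
  exact Decomp.replace hc h3 h6 h7 h8 h9

theorem Decomp.introvert {V : TauMod F τ} {s : X → Set (Fin n)} (h : Decomp V s)
    (hs : ∀ x, (s x).OrdConnected) (k : Fin n) (d₀ : Dir) :
    Decomp (V.introvert k d₀) (fun x => updateSupp k (colimSupp (V.leftArrow d₀ k).dir
      (V.rightArrow d₀ k).dir (leftMem k (s x)) (k ∈ s x) (rightMem k (s x))) (s x)) := by
  obtain ⟨c, hc⟩ := h
  obtain ⟨cl, h1, h2, h3⟩ := exists_leftCoord hc d₀ k
  obtain ⟨cr, h4, h5, h6⟩ := exists_rightCoord hc d₀ k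
  obtain ⟨cC, h7, h8, h9⟩ := colimCoord_spec h1 (hc.coord k) h4 h2 h5
    fun x => between_of_ordConnected (hs x)
  exact Decomp.replace hc h3 h6 h7 h8 h9

/-! ### Uniqueness of the decomposition -/

/-- The families of vectors which are compatible with the structure maps between vertices `b` and
`d`. -/
def sections (V : TauMod F τ) (b d : Fin n) : Submodule F (∀ i, V.space i) where
  carrier := {v | ∀ i : Fin (n - 1), b ≤ lo i → hi i ≤ d →
    (v (lo i), v (hi i)) ∈ StructMap.graph (τ i) (V.map i)}
  add_mem' h h' i h1 h2 := (StructMap.graph (τ i) (V.map i)).add_mem (h i h1 h2) (h' i h1 h2)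
  zero_mem' i _ _ := (StructMap.graph (τ i) (V.map i)).zero_mem
  smul_mem' r _ h i h1 h2 := (StructMap.graph (τ i) (V.map i)).smul_mem r (h i h1 h2)

/-- The initial vectors of the sections over `[b, d]`. -/
def initialSpace (V : TauMod F τ) (b d : Fin n) : Submodule F (V.space b) :=
  (sections V b d).map (LinearMap.proj b)

/-- The initial vectors of the sections over `[b, d]` which vanish at `d`. -/
def initialKer (V : TauMod F τ) (b d : Fin n) : Submodule F (V.space b) :=
  (sections V b d ⊓ LinearMap.ker (LinearMap.proj d)).map (LinearMap.proj b)

theorem exists_lift_coord {V : TauMod F τ} {s : X → Set (Fin n)}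
    {c : ∀ i, V.space i →ₗ[F] (X → F)} (hc : IsAdapted V s c) (f : Fin n → X → F)
    (hf : ∀ i x, i ∉ s x → f i x = 0) : ∃ v : ∀ i, V.space i, ∀ i, c i (v i) = f i := by
  choose v hv using fun i => (hc.coord i).surj (f i) (hf i)
  exact ⟨v, hv⟩

theorem mem_sections_iff {V : TauMod F τ} {s : X → Set (Fin n)}
    {c : ∀ i, V.space i →ₗ[F] (X → F)} (hc : IsAdapted V s c) {b d : Fin n}
    (v : ∀ i, V.space i) : v ∈ sections V b d ↔ ∀ i : Fin (n - 1), b ≤ lo i → hi i ≤ d →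
      graphCond (τ i) (fun x => lo i ∈ s x) (fun x => hi i ∈ s x) (c (lo i) (v (lo i)))
        (c (hi i) (v (hi i))) :=
  forall_congr' fun i => forall₂_congr fun _ _ =>
    mem_graph_iff (hc.compat i) (hc.coord _) (hc.coord _) _ _

/-- A section has constant coordinates along an interval that contains both ends. -/
theorem coord_eq_of_mem_sections {V : TauMod F τ} {s : X → Set (Fin n)}
    {c : ∀ i, V.space i →ₗ[F] (X → F)} (hc : IsAdapted V s c) {b d : Fin n}
    {v : ∀ i, V.space i} (hv : v ∈ sections V b d) {x : X} (hx : (s x).OrdConnected)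
    (hb : b ∈ s x) (hd : d ∈ s x) : ∀ (m : ℕ) (i : Fin n), i.1 = b.1 + m → i ≤ d →
      c i (v i) x = c b (v b) x := by
  intro m
  induction m with
  | zero =>
    intro i hi' _
    obtain rfl : i = b := Fin.ext hi'
    rfl
  | succ m ih =>
    intro i hi' hid
    have hin := i.2
    have hid' : i.1 ≤ d.1 := hid
    let k : Fin (n - 1) := ⟨b.1 + m, by omega⟩
    have hk : hi k = i := Fin.ext hi'.symm
    have hbk : b ≤ lo k := by rw [Fin.le_def]; simp [lo, k]
    have hkd : lo k ≤ d := by rw [Fin.le_def]; simp only [lo, k]; omega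
    have h1 := (mem_sections_iff hc v).1 hv k hbk (hk ▸ hid)
    have h2 := ih (lo k) rfl hkd
    have h3 : lo k ∈ s x := hx.out hb hd ⟨hbk, hkd⟩
    have h4 : hi k ∈ s x := by
      rw [hk]
      exact hx.out hb hd ⟨by rw [Fin.le_def]; omega, hid⟩
    rw [← hk, ← h2]
    generalize τ k = δ at h1
    cases δ
    · exact (h1 x).trans (if_pos h4)
    · exact ((h1 x).trans (if_pos h3)).symm

/-- The number of intervals which contain both `b` and `d` is determined by the module. -/
theorem card_contains {V : TauMod F τ} [Fintype X] {s : X → Set (Fin n)} (h : Decomp V s)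
    (hs : ∀ x, (s x).OrdConnected) {b d : Fin n} (hbd : b ≤ d) :
    Nat.card {x // b ∈ s x ∧ d ∈ s x} + Module.finrank F (initialKer V b d) =
      Module.finrank F (initialSpace V b d) := by
  classical
  obtain ⟨c, hc⟩ := h
  have hconst : ∀ {v : ∀ i, V.space i}, v ∈ sections V b d → ∀ x, b ∈ s x → d ∈ s x →
      c d (v d) x = c b (v b) x := fun hv x hb hd =>
    coord_eq_of_mem_sections hc hv (hs x) hb hd (d.1 - b.1) d
      (by have : b.1 ≤ d.1 := hbd; omega) le_rfl
  let Φ : initialSpace V b d →ₗ[F] ({x // b ∈ s x ∧ d ∈ s x} → F) :=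
    LinearMap.funLeft F F Subtype.val ∘ₗ c b ∘ₗ (initialSpace V b d).subtype
  have hΦ : ∀ a x, Φ a x = c b a x.1 := fun _ _ => rfl
  have hrange : LinearMap.range Φ = ⊤ := by
    rw [LinearMap.range_eq_top]
    intro f
    let g : X → F := fun x => if h : b ∈ s x ∧ d ∈ s x then f ⟨x, h⟩ else 0
    obtain ⟨v, hv⟩ := exists_lift_coord hc (fun i x => if i ∈ s x then g x else 0)
      (fun i x hx => if_neg hx)
    have hvs : v ∈ sections V b d := by
      rw [mem_sections_iff hc]
      intro i h1 h2
      rw [hv, hv]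
      have hle : lo i ≤ hi i := by rw [Fin.le_def]; simp [lo, hi]
      have hx : ∀ x, b ∈ s x ∧ d ∈ s x → lo i ∈ s x ∧ hi i ∈ s x := fun x hx =>
        ⟨(hs x).out hx.1 hx.2 ⟨h1, hle.trans h2⟩, (hs x).out hx.1 hx.2 ⟨h1.trans hle, h2⟩⟩
      generalize τ i = δ
      cases δ <;> intro x <;> have := hx x <;> by_cases h : b ∈ s x ∧ d ∈ s x <;>
        simp [g, h, this]
    refine ⟨⟨v b, ⟨v, hvs, rfl⟩⟩, ?_⟩
    ext x
    rw [hΦ]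
    dsimp only
    rw [hv]
    simp [g, x.2]
  have hker : (LinearMap.ker Φ).map (initialSpace V b d).subtype = initialKer V b d := by
    ext a
    constructor
    · rintro ⟨⟨a, v, hv, rfl⟩, ha, rfl⟩
      -- Keep only the coordinates of the intervals which start at or before `b`.
      obtain ⟨w, hw⟩ := exists_lift_coord hc (fun i x => if b ∈ s x then c i (v i) x else 0)
        (fun i x hx => by rw [(hc.coord i).supp _ _ hx, ite_self])
      have hws : w ∈ sections V b d := by
        rw [mem_sections_iff hc]
        intro i h1 h2
        have := (mem_sections_iff hc v).1 hv i h1 h2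
        rw [hw, hw]
        generalize τ i = δ at this ⊢
        cases δ <;> intro x <;> dsimp only <;> rw [this x] <;> split_ifs <;> rfl
      refine ⟨w, ⟨hws, ?_⟩, ?_⟩
      · apply (hc.coord d).inj
        ext x
        change c d (w d) x = 0
        rw [hw]
        dsimp only
        split_ifs with hb
        · by_cases hd : d ∈ s x
          · rw [hconst hv x hb hd]
            exact congrFun ha ⟨x, hb, hd⟩
          · exact (hc.coord d).supp _ _ hd
        · rfl
      · apply (hc.coord b).ext
        intro x
        change c b (w b) x = c b (v b) x
        rw [hw]
        dsimp only
        split_ifs with hb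
        · rfl
        · exact ((hc.coord b).supp _ _ hb).symm
    · rintro ⟨v, ⟨hv, hvd⟩, rfl⟩
      refine ⟨⟨v b, v, hv, rfl⟩, ?_, rfl⟩
      ext x
      rw [hΦ]
      dsimp only
      rw [← hconst hv x x.2.1 x.2.2, show v d = 0 from hvd, map_zero]
      rfl
  have h1 := LinearMap.finrank_range_add_finrank_ker Φ
  rw [hrange, finrank_top, Module.finrank_fintype_fun_eq_card, ← Nat.card_eq_fintype_card] at h1
  rw [← hker, Submodule.finrank_map_subtype_eq, h1]

theorem exists_equiv_of_card_fiber {α β : Type} {γ : Type*} [Finite α] [Finite β] (f : α → γ)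
    (g : β → γ) (h : ∀ c, Nat.card {a // f a = c} = Nat.card {b // g b = c}) :
    ∃ e : α ≃ β, ∀ a, g (e a) = f a := by
  have e : ∀ c, Nonempty ({a // f a = c} ≃ {b // g b = c}) := fun c =>
    ⟨(Finite.card_eq.1 (h c)).some⟩
  refine ⟨(Equiv.sigmaFiberEquiv f).symm.trans ((Equiv.sigmaCongrRight fun c => (e c).some).trans
    (Equiv.sigmaFiberEquiv g)), fun a => ?_⟩
  exact ((e (f a)).some ⟨a, rfl⟩).2

theorem exists_eq_Icc {J : Set (Fin n)} (h : J.Nonempty) (hJ : J.OrdConnected) :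
    ∃ b d, b ≤ d ∧ J = Set.Icc b d := by
  obtain ⟨b, hb⟩ := J.toFinite.exists_minimal h
  obtain ⟨d, hd⟩ := J.toFinite.exists_maximal h
  have h1 : ∀ i ∈ J, b ≤ i := fun i hi => (le_total b i).elim id fun h => hb.2 hi h
  have h2 : ∀ i ∈ J, i ≤ d := fun i hi => (le_total i d).elim id fun h => hd.2 hi h
  exact ⟨b, d, h1 d hd.1, Set.Subset.antisymm (fun i hi => ⟨h1 i hi, h2 i hi⟩)
    (hJ.out hb.1 hd.1)⟩

/-- If every nonempty interval is contained in as many `s x` as `t y`, then it equals as many `s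
x` as `t y`. -/
theorem card_eq_of_card_contains [Fintype X] [Fintype Y] {s : X → Set (Fin n)}
    {t : Y → Set (Fin n)} (hs : ∀ x, (s x).OrdConnected) (ht : ∀ y, (t y).OrdConnected)
    (h : ∀ J : Set (Fin n), J.Nonempty → J.OrdConnected →
      Nat.card {x // J ⊆ s x} = Nat.card {y // J ⊆ t y}) (J : Set (Fin n)) (hJ : J.Nonempty) :
    Nat.card {x // s x = J} = Nat.card {y // t y = J} := by
  classical
  have split : ∀ {Z : Type} [Fintype Z] (r : Z → Set (Fin n)) (J : Set (Fin n)),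
      Nat.card {z // J ⊆ r z} = Nat.card {z // r z = J} +
        ∑ K ∈ Finset.univ.filter (J ⊂ ·), Nat.card {z // r z = K} := by
    intro Z _ r J
    simp only [Nat.card_eq_fintype_card, Fintype.card_subtype]
    rw [Finset.card_eq_sum_card_fiberwise (f := r) (t := Finset.univ.filter (J ⊆ ·))
      (fun z hz => by simpa using hz)]
    have : Finset.univ.filter (J ⊆ ·) = insert J (Finset.univ.filter (J ⊂ ·)) := by
      ext K
      simp only [Finset.mem_filter, Finset.mem_univ, true_and, Finset.mem_insert]
      rw [Set.ssubset_iff_subset_ne]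
      constructor
      · intro h
        by_cases e : J = K
        · exact Or.inl e.symm
        · exact Or.inr ⟨h, e⟩
      · rintro (rfl | h)
        · exact subset_rfl
        · exact h.1
    rw [this, Finset.sum_insert (by simp)]
    congr 1
    · congr 1
      ext z
      simp only [Finset.mem_filter, Finset.mem_univ, true_and, and_iff_right_iff_imp]
      rintro rfl
      exact subset_rfl
    · refine Finset.sum_congr rfl fun K hK => ?_
      congr 1
      ext z
      simp only [Finset.mem_filter, Finset.mem_univ, true_and, and_iff_right_iff_imp] at hK ⊢
      rintro rfl
      exact hK.1
  induction J using WellFoundedGT.induction with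
  | ind J ih =>
    by_cases hJ' : J.OrdConnected
    · have h1 := h J hJ hJ'
      rw [split, split, Finset.sum_congr rfl fun K hK => ih K (Finset.mem_filter.1 hK).2
        (hJ.mono (Finset.mem_filter.1 hK).2.1)] at h1
      exact Nat.add_right_cancel h1
    · have : IsEmpty {x // s x = J} := ⟨fun x => hJ' (x.2 ▸ hs x.1)⟩
      have : IsEmpty {y // t y = J} := ⟨fun x => hJ' (x.2 ▸ ht x.1)⟩
      simp

/-- Uniqueness of the interval decomposition, up to empty supports. -/
theorem Decomp.unique {V : TauMod F τ} [Finite X] [Finite Y] {s : X → Set (Fin n)}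
    {t : Y → Set (Fin n)} (h : Decomp V s) (h' : Decomp V t) (hs : ∀ x, (s x).OrdConnected)
    (ht : ∀ y, (t y).OrdConnected) :
    ∃ e : {x // (s x).Nonempty} ≃ {y // (t y).Nonempty}, ∀ x, t (e x) = s x := by
  have := Fintype.ofFinite X
  have := Fintype.ofFinite Y
  have key := card_eq_of_card_contains hs ht fun J hJ hJ' => by
    obtain ⟨b, d, hbd, rfl⟩ := exists_eq_Icc hJ hJ'
    have e : ∀ {Z : Type} (r : Z → Set (Fin n)) (hr : ∀ z, (r z).OrdConnected),
        Nat.card {z // Set.Icc b d ⊆ r z} = Nat.card {z // b ∈ r z ∧ d ∈ r z} := fun r hr =>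
      Nat.card_congr (Equiv.subtypeEquivRight fun z =>
        ⟨fun h => ⟨h ⟨le_rfl, hbd⟩, h ⟨hbd, le_rfl⟩⟩, fun h => (hr z).out h.1 h.2⟩)
    rw [e s hs, e t ht]
    have h1 := card_contains h hs hbd
    have h2 := card_contains h' ht hbd
    omega
  refine exists_equiv_of_card_fiber (fun x : {x // (s x).Nonempty} => s x)
    (fun y : {y // (t y).Nonempty} => t y) fun J => ?_
  by_cases hJ : J.Nonempty
  · have e : ∀ {Z : Type} (r : Z → Set (Fin n)),
        Nat.card {z : {z // (r z).Nonempty} // r z = J} = Nat.card {z // r z = J} := fun r =>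
      Nat.card_congr (Equiv.subtypeSubtypeEquivSubtype (p := fun z => (r z).Nonempty)
        (q := fun z => r z = J) fun {z} hz => by rw [hz]; exact hJ)
    rw [e s, e t, key J hJ]
  · have : IsEmpty {x : {x // (s x).Nonempty} // s x = J} := ⟨fun x => hJ (x.2 ▸ x.1.2)⟩
    have : IsEmpty {x : {x // (t x).Nonempty} // t x = J} := ⟨fun x => hJ (x.2 ▸ x.1.2)⟩
    simp

/-! ### Bases adapted to a chain of subspaces -/

/-- `K` is a coordinate subspace. -/
def IsCoordSubspace {A : Type*} [AddCommGroup A] [Module F A] (c : A →ₗ[F] (X → F))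
    (K : Submodule F A) : Prop := ∃ P : X → Prop, ∀ v, v ∈ K ↔ ∀ x, ¬ P x → c v x = 0

/-- A descending chain `T :: l` of subspaces has an adapted basis: start with a basis of the
smallest space and extend it step by step. -/
theorem exists_linearIndepOn_adapted {A : Type*} [AddCommGroup A] [Module F A]
    (l : List (Submodule F A)) : ∀ T : Submodule F A, (T :: l).Pairwise (· ≥ ·) →
      ∃ B : Set A, LinearIndepOn F id B ∧ B ⊆ T ∧ (T : Set A) ⊆ Submodule.span F B ∧
        ∀ K ∈ l, K ≤ Submodule.span F (B ∩ K) := by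
  induction l with
  | nil =>
    intro T _
    obtain ⟨B, hB, _, h1, h2⟩ := exists_linearIndepOn_id_extension
      (linearIndepOn_empty F (id : A → A)) (Set.empty_subset (T : Set A))
    exact ⟨B, h2, hB, h1, by simp⟩
  | cons K l ih =>
    intro T hT
    rw [List.pairwise_cons] at hT
    obtain ⟨B, h1, h2, h3, h4⟩ := ih K hT.2
    have hKT : K ≤ T := hT.1 K (by simp)
    obtain ⟨B', h5, h6, h7, h8⟩ := exists_linearIndepOn_id_extension h1
      (h2.trans (SetLike.coe_subset_coe.2 hKT))
    refine ⟨B', h8, h5, h7, fun K' hK' => ?_⟩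
    rcases List.mem_cons.1 hK' with rfl | hK'
    · exact fun v hv => Submodule.span_mono (Set.subset_inter h6 h2) (h3 hv)
    · exact (h4 K' hK').trans (Submodule.span_mono (Set.inter_subset_inter_left _ h6))

theorem exists_coord_adapted {A : Type*} [AddCommGroup A] [Module F A] [FiniteDimensional F A]
    (l : List (Submodule F A)) (hl : l.Pairwise (· ≥ ·)) :
    ∃ (r : ℕ) (b : Module.Basis (Fin r) F A), ∀ K ∈ l, ∀ v, v ∈ K ↔
      ∀ x, b x ∉ K → b.equivFun v x = 0 := by
  obtain ⟨B, h1, -, h3, h4⟩ := exists_linearIndepOn_adapted l ⊤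
    (List.pairwise_cons.2 ⟨fun _ _ => le_top, hl⟩)
  have hfin : Finite B := (show LinearIndependent F (fun x : B => (x : A)) from h1).finite
  let b₀ : Module.Basis B F A := Module.Basis.mk
    (show LinearIndependent F (fun x : B => (x : A)) from h1) (by simpa using h3)
  let e := Finite.equivFin B
  refine ⟨_, b₀.reindex e, fun K hK v => ⟨fun hv => ?_, fun hv => ?_⟩⟩
  · set b := b₀.reindex e
    intro x hx
    have : Submodule.span F (B ∩ K) ≤ LinearMap.ker (b.coord x) := by
      rw [Submodule.span_le]
      rintro w ⟨hw, hwK⟩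
      have hbw : b (e ⟨w, hw⟩) = w := by
        simp only [b, b₀, Module.Basis.reindex_apply, Equiv.symm_apply_apply, Module.Basis.mk_apply]
      have : e ⟨w, hw⟩ ≠ x := by
        rintro rfl
        exact hx (by rw [hbw]; exact hwK)
      change b.coord x w = 0
      rw [← hbw, Module.Basis.coord_apply, Module.Basis.repr_self,
        Finsupp.single_eq_of_ne this.symm]
    exact this (h4 K hK hv)
  · rw [← (b₀.reindex e).sum_equivFun v]
    refine K.sum_mem fun x _ => ?_
    by_cases hx : (b₀.reindex e) x ∈ K
    · exact K.smul_mem _ hx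
    · rw [hv x hx, zero_smul]
      exact K.zero_mem

theorem pairwise_map_of_monotone {α β : Type*} [Preorder α] [Preorder β] {f : α → β}
    (hf : Monotone f) {l : List α} (hl : l.Pairwise (· ≥ ·)) : (l.map f).Pairwise (· ≥ ·) :=
  List.pairwise_map.2 (hl.imp fun h => hf h)

/-- A surjection has a linear section which is compatible with a given chain of subspaces. -/
theorem exists_section_adapted {A Q : Type*} [AddCommGroup A] [Module F A] [AddCommGroup Q]
    [Module F Q] [FiniteDimensional F Q] (π : A →ₗ[F] Q) (hπ : Function.Surjective π)
    (l : List (Submodule F A)) (hl : l.Pairwise (· ≥ ·)) :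
    ∃ σ : Q →ₗ[F] A, (∀ q, π (σ q) = q) ∧ ∀ K ∈ l, ∀ q ∈ K.map π, σ q ∈ K := by
  obtain ⟨r, b, hb⟩ := exists_coord_adapted (l.map (Submodule.map π))
    (pairwise_map_of_monotone (fun _ _ h => Submodule.map_mono h) hl)
  -- Lift each basis vector to the smallest subspace of the chain that allows it.
  have lift : ∀ q, ∃ a, π a = q ∧ ∀ K ∈ l, q ∈ K.map π → a ∈ K := by
    intro q
    clear hb
    induction l with
    | nil =>
      obtain ⟨a, ha⟩ := hπ q
      exact ⟨a, ha, by simp⟩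
    | cons K l ih =>
      rw [List.pairwise_cons] at hl
      by_cases h : ∃ K' ∈ l, q ∈ K'.map π
      · obtain ⟨a, ha, h1⟩ := ih hl.2
        obtain ⟨K', hK', hq⟩ := h
        refine ⟨a, ha, fun K'' hK'' hq' => ?_⟩
        rcases List.mem_cons.1 hK'' with rfl | hK''
        · exact hl.1 K' hK' (h1 K' hK' hq)
        · exact h1 K'' hK'' hq'
      · push Not at h
        by_cases hq : q ∈ K.map π
        · obtain ⟨a, ha, rfl⟩ := hq
          refine ⟨a, rfl, fun K'' hK'' hq' => ?_⟩
          rcases List.mem_cons.1 hK'' with rfl | hK''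
          · exact ha
          · exact absurd hq' (h K'' hK'')
        · obtain ⟨a, ha⟩ := hπ q
          refine ⟨a, ha, fun K'' hK'' hq' => ?_⟩
          rcases List.mem_cons.1 hK'' with rfl | hK''
          · exact absurd hq' hq
          · exact absurd hq' (h K'' hK'')
  choose v hv1 hv2 using fun x => lift (b x)
  refine ⟨b.constr F v, fun q => ?_, fun K hK q hq => ?_⟩
  · have : π ∘ₗ b.constr F v = LinearMap.id := b.ext fun x => by simp [hv1]
    exact LinearMap.congr_fun this q
  · rw [Module.Basis.constr_apply_fintype]
    refine K.sum_mem fun x _ => ?_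
    by_cases hx : b x ∈ K.map π
    · exact K.smul_mem _ (hv2 x K hK hx)
    · rw [(hb _ (List.mem_map_of_mem hK) q).1 hq x hx, zero_smul]
      exact K.zero_mem

/-! ### Existence of the decomposition -/

open Classical in
/-- Adapted coordinates are pushed forward along `f`: the coordinates on `A` outside the kernel of
`f` become coordinates on the range of `f`, and `Fin r` indexes a complement of the range. -/
theorem exists_coord_fwd {A B : Type*} [AddCommGroup A] [Module F A] [AddCommGroup B] [Module F B]
    [FiniteDimensional F B] (f : A →ₗ[F] B) {cA : A →ₗ[F] (X → F)} {p : X → Prop}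
    (hA : IsCoord cA p) (l : List (Submodule F B)) (hl : l.Pairwise (· ≥ ·))
    (hker : IsCoordSubspace cA (LinearMap.ker f))
    (had : ∀ K ∈ l, IsCoordSubspace cA (K.comap f)) :
    ∃ (r : ℕ) (q : X → Prop) (cB : B →ₗ[F] (X ⊕ Fin r → F)), (∀ x, q x → p x) ∧
      IsCoord cB (Sum.elim q fun _ => True) ∧
      (∀ a x, cB (f a) (Sum.inl x) = if q x then cA a x else 0) ∧
      (∀ a y, cB (f a) (Sum.inr y) = 0) ∧ ∀ K ∈ l, IsCoordSubspace cB K := by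
  obtain ⟨Z, hZ⟩ := hker
  let π := (LinearMap.range f).mkQ
  have hπ : Function.Surjective π := Submodule.mkQ_surjective _
  obtain ⟨r, b, hb⟩ := exists_coord_adapted (l.map (Submodule.map π))
    (pairwise_map_of_monotone (fun _ _ h => Submodule.map_mono h) hl)
  obtain ⟨σ, hσ, hσK⟩ := exists_section_adapted π hπ l hl
  obtain ⟨g, hg⟩ := f.rangeRestrict.exists_rightInverse_of_surjective f.range_rangeRestrict
  have hg' : ∀ y, f (g y) = y := fun y => congrArg Subtype.val (LinearMap.congr_fun hg y)
  have hπf : ∀ a, π (f a) = 0 := fun a =>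
    (Submodule.Quotient.mk_eq_zero _).2 ⟨a, rfl⟩
  -- The component of a vector in the range of `f`.
  let ρ : B →ₗ[F] LinearMap.range f := LinearMap.codRestrict _ (LinearMap.id - σ ∘ₗ π) fun v =>
    (Submodule.Quotient.mk_eq_zero _).1 (show π ((LinearMap.id - σ ∘ₗ π : B →ₗ[F] B) v) = 0 by
      rw [LinearMap.sub_apply, map_sub, LinearMap.comp_apply, hσ]; exact sub_self _)
  have hρ : ∀ v, f (g (ρ v)) = v - σ (π v) := fun v => hg' _
  obtain ⟨q, hq⟩ : ∃ q : X → Prop, ∀ x, q x ↔ p x ∧ ¬ Z x := ⟨_, fun _ => Iff.rfl⟩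
  let cB : B →ₗ[F] (X ⊕ Fin r → F) := LinearMap.pi fun z => Sum.elim
    (fun x => if q x then LinearMap.proj x ∘ₗ cA ∘ₗ g ∘ₗ ρ else 0)
    (fun y => LinearMap.proj y ∘ₗ b.equivFun.toLinearMap ∘ₗ π) z
  have hl' : ∀ v x, cB v (Sum.inl x) = if q x then cA (g (ρ v)) x else 0 := by
    intro v x
    simp only [cB, LinearMap.pi_apply, Sum.elim_inl]
    split_ifs <;> rfl
  have hr' : ∀ v y, cB v (Sum.inr y) = b.equivFun (π v) y := fun v y => rfl
  -- Two preimages of the same vector agree in the coordinates which survive.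
  have heq : ∀ a a', f a = f a' → ∀ x, q x → cA a x = cA a' x := by
    intro a a' h x hx
    have := (hZ (a - a')).1 (by rw [LinearMap.mem_ker, map_sub, h, sub_self]) x ((hq x).1 hx).2
    rwa [map_sub, Pi.sub_apply, sub_eq_zero] at this
  have hfl : ∀ a x, cB (f a) (Sum.inl x) = if q x then cA a x else 0 := by
    intro a x
    rw [hl']
    split_ifs with hx
    · exact heq _ _ (by rw [hρ, hπf, map_zero, sub_zero]) x hx
    · rfl
  have hσ0 : ∀ v x, cB (σ v) (Sum.inl x) = 0 := by
    intro v x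
    rw [hl']
    split_ifs with hx
    · refine (heq _ 0 ?_ x hx).trans ?_
      · rw [hρ, hσ, sub_self, map_zero]
      · rw [map_zero, Pi.zero_apply]
    · rfl
  refine ⟨r, q, cB, fun x hx => ((hq x).1 hx).1, ⟨fun v hv => ?_, ?_, fun h hh => ?_⟩, hfl,
    fun a y => by rw [hr', hπf, map_zero]; rfl, fun K hK => ?_⟩
  · have h1 : π v = 0 := b.equivFun.map_eq_zero_iff.1 (funext fun y => by
      rw [← hr', hv]; rfl)
    obtain ⟨a, rfl⟩ : v ∈ LinearMap.range f := (Submodule.Quotient.mk_eq_zero _).1 h1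
    refine (hZ a).2 fun x hx => ?_
    by_cases hp : p x
    · have := hfl a x
      rw [if_pos ((hq x).2 ⟨hp, hx⟩), hv] at this
      exact this.symm
    · exact hA.supp a x hp
  · rintro v (x | y) hx
    · exact (hl' v x).trans (if_neg hx)
    · exact absurd trivial hx
  · obtain ⟨a, ha⟩ := hA.surj (fun x => if q x then h (Sum.inl x) else 0) fun x hx =>
      if_neg fun h => hx ((hq x).1 h).1
    refine ⟨f a + σ (b.equivFun.symm fun y => h (Sum.inr y)), ?_⟩
    ext z
    rw [map_add, Pi.add_apply]
    cases z with
    | inl x =>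
      rw [hσ0, add_zero, hfl, ha]
      dsimp only
      split_ifs with hx
      · rfl
      · exact (hh (Sum.inl x) hx).symm
    | inr y =>
      rw [hr', hr', hπf, hσ, map_zero, LinearEquiv.apply_symm_apply, Pi.zero_apply, zero_add]
  · obtain ⟨P, hP⟩ := had K hK
    have hbK := hb _ (List.mem_map_of_mem hK)
    refine ⟨Sum.elim P fun y => b y ∈ K.map π, fun v => ⟨fun hv => ?_, fun hv => ?_⟩⟩
    · have h1 : π v ∈ K.map π := ⟨v, hv, rfl⟩
      have h2 : g (ρ v) ∈ K.comap f := by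
        rw [Submodule.mem_comap, hρ]
        exact K.sub_mem hv (hσK K hK _ h1)
      rintro (x | y) hx
      · rw [hl', (hP _).1 h2 x hx, ite_self]
      · exact (hbK _).1 h1 y hx
    · have h1 : π v ∈ K.map π := (hbK _).2 fun y hy => hv (Sum.inr y) hy
      have h2 : g (ρ v) ∈ K.comap f := by
        refine (hP _).2 fun x hx => ?_
        by_cases hqx : q x
        · have := hv (Sum.inl x) hx
          rwa [hl', if_pos hqx] at this
        · by_cases hp : p x
          · -- A coordinate of the kernel is also a coordinate of the preimage of `K`.
            have hZx : Z x := by_contra fun h => hqx ((hq x).2 ⟨hp, h⟩)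
            obtain ⟨a, ha⟩ := hA.exists_single hp
            have h3 : a ∈ LinearMap.ker f := (hZ a).2 fun y hy => by
              rw [ha, Pi.single_eq_of_ne]
              rintro rfl
              exact hy hZx
            have h4 : a ∈ K.comap f := by
              rw [Submodule.mem_comap, LinearMap.mem_ker.1 h3]
              exact K.zero_mem
            have := (hP a).1 h4 x hx
            rw [ha] at this
            simp at this
          · exact hA.supp _ _ hp
      rw [Submodule.mem_comap, hρ] at h2
      have := K.add_mem h2 (hσK K hK _ h1)
      rwa [sub_add_cancel] at this

/-- Adapted coordinates are pulled back along `f`: the coordinates on the range of `f` lift to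
`B`, and `Fin r` indexes a basis of the kernel. -/
theorem exists_coord_bwd {A B : Type*} [AddCommGroup A] [Module F A] [AddCommGroup B] [Module F B]
    [FiniteDimensional F A] [FiniteDimensional F B] (f : B →ₗ[F] A) {cA : A →ₗ[F] (X → F)}
    {p : X → Prop}
    (hA : IsCoord cA p) (l : List (Submodule F B)) (hl : l.Pairwise (· ≥ ·))
    (hrange : IsCoordSubspace cA (LinearMap.range f))
    (had : ∀ K ∈ l, IsCoordSubspace cA (K.map f)) :
    ∃ (r : ℕ) (q : X → Prop) (cB : B →ₗ[F] (X ⊕ Fin r → F)), (∀ x, q x → p x) ∧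
      IsCoord cB (Sum.elim q fun _ => True) ∧
      (∀ b x, cA (f b) x = cB b (Sum.inl x)) ∧ ∀ K ∈ l, IsCoordSubspace cB K := by
  obtain ⟨Z, hZ⟩ := hrange
  obtain ⟨r, b, hb⟩ := exists_coord_adapted
    (l.map (Submodule.comap (LinearMap.ker f).subtype))
    (pairwise_map_of_monotone (fun _ _ h => Submodule.comap_mono h) hl)
  obtain ⟨σ, hσ, hσK⟩ := exists_section_adapted f.rangeRestrict f.surjective_rangeRestrict l hl
  have hσ' : ∀ y, f (σ y) = y := fun y => congrArg Subtype.val (hσ y)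
  -- The component of a vector in the kernel of `f`.
  let ρ : B →ₗ[F] LinearMap.ker f := LinearMap.codRestrict _
    (LinearMap.id - σ ∘ₗ f.rangeRestrict) fun v => by
      rw [LinearMap.mem_ker, LinearMap.sub_apply, map_sub, LinearMap.comp_apply, hσ']
      exact sub_self _
  have hρ : ∀ v, (ρ v : B) = v - σ (f.rangeRestrict v) := fun v => rfl
  let cB : B →ₗ[F] (X ⊕ Fin r → F) := LinearMap.pi fun z => Sum.elim
    (fun x => LinearMap.proj x ∘ₗ cA ∘ₗ f)
    (fun y => LinearMap.proj y ∘ₗ b.equivFun.toLinearMap ∘ₗ ρ) z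
  have hl' : ∀ v x, cB v (Sum.inl x) = cA (f v) x := fun v x => rfl
  have hr' : ∀ v y, cB v (Sum.inr y) = b.equivFun (ρ v) y := fun v y => rfl
  refine ⟨r, fun x => p x ∧ Z x, cB, fun x hx => hx.1, ⟨fun v hv => ?_, ?_, fun h hh => ?_⟩,
    fun _ _ => rfl, fun K hK => ?_⟩
  · have h1 : f v = 0 := hA.inj _ (funext fun x => (hl' v x).symm.trans (congrFun hv _))
    have h2 : ρ v = 0 := b.equivFun.map_eq_zero_iff.1 (funext fun y => by
      rw [← hr', hv]; rfl)
    have h3 := hρ v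
    rw [h2, show f.rangeRestrict v = 0 from Subtype.ext h1, map_zero, sub_zero] at h3
    exact h3.symm
  · rintro v (x | y) hx
    · rw [hl']
      by_cases hp : p x
      · exact (hZ _).1 ⟨v, rfl⟩ x fun h => hx ⟨hp, h⟩
      · exact hA.supp _ _ hp
    · exact absurd trivial hx
  · obtain ⟨a, ha⟩ := hA.surj (fun x => h (Sum.inl x)) fun x hx => hh _ fun h => hx h.1
    have haR : a ∈ LinearMap.range f := (hZ a).2 fun x hx => by
      rw [ha]
      exact hh _ fun h => hx h.2
    have h1 : f.rangeRestrict (b.equivFun.symm fun y => h (Sum.inr y) : LinearMap.ker f) = 0 :=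
      Subtype.ext (LinearMap.mem_ker.1 (b.equivFun.symm fun y => h (Sum.inr y)).2)
    refine ⟨σ ⟨a, haR⟩ + (b.equivFun.symm fun y => h (Sum.inr y) : LinearMap.ker f), ?_⟩
    ext z
    cases z with
    | inl x =>
      rw [hl', map_add, hσ', LinearMap.mem_ker.1 (b.equivFun.symm fun y => h (Sum.inr y)).2,
        add_zero, ha]
    | inr y =>
      rw [hr']
      have : ρ (σ ⟨a, haR⟩ + (b.equivFun.symm fun y => h (Sum.inr y) : LinearMap.ker f)) =
          b.equivFun.symm fun y => h (Sum.inr y) := by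
        apply Subtype.ext
        rw [hρ, map_add, h1, hσ, add_zero, add_sub_cancel_left]
      rw [this, LinearEquiv.apply_symm_apply]
  · obtain ⟨P, hP⟩ := had K hK
    have hbK := hb _ (List.mem_map_of_mem hK)
    have hmap : ∀ v, f v ∈ K.map f → σ (f.rangeRestrict v) ∈ K := by
      rintro v ⟨w, hw, e⟩
      exact hσK K hK _ ⟨w, hw, Subtype.ext e⟩
    refine ⟨Sum.elim P fun y => b y ∈ K.comap (LinearMap.ker f).subtype, fun v =>
      ⟨fun hv => ?_, fun hv => ?_⟩⟩
    · have h1 : f v ∈ K.map f := ⟨v, hv, rfl⟩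
      rintro (x | y) hx
      · exact (hP _).1 h1 x hx
      · refine (hbK _).1 ?_ y hx
        change (ρ v : B) ∈ K
        rw [hρ]
        exact K.sub_mem hv (hmap v h1)
    · have h1 : f v ∈ K.map f := (hP _).2 fun x hx => hv (Sum.inl x) hx
      have h2 : (ρ v : B) ∈ K := (hbK (ρ v)).2 fun y hy => hv (Sum.inr y) hy
      rw [hρ] at h2
      have := K.add_mem h2 (hmap v h1)
      rwa [sub_add_cancel] at this

/-- The restriction of `V` to the vertices up to `k` decomposes, compatibly with any given chain of
subspaces of the last space. -/
theorem exists_prefix_decomp (V : TauMod F τ) (m : ℕ) : ∀ (k : Fin n), k.1 = m →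
    ∀ l : List (Submodule F (V.space k)), l.Pairwise (· ≥ ·) →
    ∃ (X : Type) (_ : Finite X) (s : X → Set (Fin n)) (c : ∀ i, V.space i →ₗ[F] (X → F)),
      (∀ x, (s x).OrdConnected) ∧ (∀ x, ∀ i ∈ s x, i ≤ k) ∧
      (∀ i ≤ k, IsCoord (c i) (fun x => i ∈ s x)) ∧
      (∀ i, hi i ≤ k → Compat (τ i) (V.map i) (c (lo i)) (c (hi i)) (fun x => lo i ∈ s x)
        (fun x => hi i ∈ s x)) ∧ ∀ K ∈ l, IsCoordSubspace (c k) K := by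
  induction m with
  | zero =>
    intro k hk l hl
    obtain ⟨r, b, hb⟩ := exists_coord_adapted l hl
    refine ⟨Fin r, inferInstance, fun _ => {k}, Function.update (fun i => 0) k
      b.equivFun.toLinearMap, fun _ => Set.ordConnected_singleton, fun _ i hi => hi.le,
      fun i hi => ?_, fun i hi' => ?_, fun K hK => ?_⟩
    · obtain rfl : i = k := Fin.ext (by have : i.1 ≤ k.1 := hi; omega)
      rw [Function.update_self]
      exact ⟨fun a ha => b.equivFun.map_eq_zero_iff.1 ha, fun a x hx => absurd rfl hx,
        fun f _ => ⟨b.equivFun.symm f, b.equivFun.apply_symm_apply f⟩⟩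
    · have : i.1 + 1 ≤ k.1 := hi'
      omega
    · rw [Function.update_self]
      exact ⟨fun x => b x ∈ K, hb K hK⟩
  | succ m ih =>
    intro k hk l hl
    have hkn := k.2
    obtain ⟨j, rfl⟩ : ∃ j : Fin (n - 1), hi j = k := ⟨⟨m, by omega⟩, Fin.ext hk.symm⟩
    have hj : (lo j).1 = m := by simpa [hi, lo] using hk
    have hlohi : ∀ i : Fin n, i ≤ lo j ↔ i ≠ hi j ∧ i ≤ hi j := by
      intro i
      rw [Fin.le_def, Fin.le_def, Ne, Fin.ext_iff]
      simp only [lo, hi]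
      omega
    -- The extension of a decomposition up to `lo j` by coordinates at `hi j`.
    have main : ∀ (X : Type) (_ : Finite X) (s : X → Set (Fin n))
        (c : ∀ i, V.space i →ₗ[F] (X → F)), (∀ x, (s x).OrdConnected) →
        (∀ x, ∀ i ∈ s x, i ≤ lo j) → (∀ i ≤ lo j, IsCoord (c i) (fun x => i ∈ s x)) →
        (∀ i, hi i ≤ lo j → Compat (τ i) (V.map i) (c (lo i)) (c (hi i)) (fun x => lo i ∈ s x)
          (fun x => hi i ∈ s x)) →
        ∀ (r : ℕ) (q : X → Prop) (cB : V.space (hi j) →ₗ[F] (X ⊕ Fin r → F)),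
        (∀ x, q x → lo j ∈ s x) → IsCoord cB (Sum.elim q fun _ => True) →
        (∀ cA : V.space (lo j) →ₗ[F] (X ⊕ Fin r → F), (∀ a x, cA a (Sum.inl x) = c _ a x) →
          (∀ a y, cA a (Sum.inr y) = 0) → Compat (τ j) (V.map j) cA cB
            (Sum.elim (fun x => lo j ∈ s x) fun _ => False) (Sum.elim q fun _ => True)) →
        (∀ K ∈ l, IsCoordSubspace cB K) →
        ∃ (X : Type) (_ : Finite X) (s : X → Set (Fin n)) (c : ∀ i, V.space i →ₗ[F] (X → F)),
        (∀ x, (s x).OrdConnected) ∧ (∀ x, ∀ i ∈ s x, i ≤ hi j) ∧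
        (∀ i ≤ hi j, IsCoord (c i) (fun x => i ∈ s x)) ∧
        (∀ i, hi i ≤ hi j → Compat (τ i) (V.map i) (c (lo i)) (c (hi i)) (fun x => lo i ∈ s x)
          (fun x => hi i ∈ s x)) ∧ ∀ K ∈ l, IsCoordSubspace (c (hi j)) K := by
      intro X _ s c h1 h2 h3 h4 r q cB h5 h6 h7 h8
      let s' : X ⊕ Fin r → Set (Fin n) :=
        Sum.elim (fun x => {i | i ∈ s x ∨ (i = hi j ∧ q x)}) fun _ => {hi j}
      let c₀ : ∀ i, V.space i →ₗ[F] (X ⊕ Fin r → F) := fun i => LinearMap.pi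
        (Sum.elim (fun x => LinearMap.proj x ∘ₗ c i) fun _ => 0)
      have hs1 : ∀ z, hi j ∈ s' z ↔ Sum.elim q (fun _ => True) z := by
        rintro (x | y)
        · have : hi j ∉ s x := fun h => ((hlohi _).1 (h2 x _ h)).1 rfl
          simp [s', this]
        · simp [s']
      have hs2 : ∀ i, i ≠ hi j → ∀ z,
          i ∈ s' z ↔ Sum.elim (fun x => i ∈ s x) (fun _ => False) z := by
        rintro i hi' (x | y) <;> simp [s', hi']
      refine ⟨X ⊕ Fin r, inferInstance, s', Function.update c₀ (hi j) cB, ?_, ?_, ?_, ?_, ?_⟩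
      · rintro (x | y)
        · by_cases hq : q x
          · refine ⟨fun a ha b hb i hi' => ?_⟩
            simp only [s', Sum.elim_inl, Set.mem_ofPred_eq, hq, and_true] at ha hb ⊢
            by_cases hij : i = hi j
            · exact Or.inr hij
            left
            rcases hb with hb | rfl
            · rcases ha with ha | rfl
              · exact (h1 x).out ha hb hi'
              · exact absurd (le_antisymm (hi'.2.trans (((hlohi _).1 (h2 x _ hb)).2)) hi'.1) hij
            · rcases ha with ha | rfl
              · exact (h1 x).out ha (h5 x hq) ⟨hi'.1, (hlohi i).2 ⟨hij, hi'.2⟩⟩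
              · exact absurd (le_antisymm hi'.2 hi'.1) hij
          · simpa [s', hq] using h1 x
        · exact Set.ordConnected_singleton
      · rintro (x | y) i hi'
        · rcases hi' with h | h
          · exact ((hlohi _).1 (h2 x _ h)).2
          · exact h.1.le
        · exact le_of_eq hi'
      · intro i hij
        by_cases h : i = hi j
        · subst h
          rw [Function.update_self]
          simp only [hs1]
          exact h6
        · rw [Function.update_of_ne h]
          simp only [hs2 i h]
          have hc := h3 i ((hlohi i).2 ⟨h, hij⟩)
          refine ⟨fun a ha => hc.inj a (funext fun x => congrFun ha (Sum.inl x)), ?_, ?_⟩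
          · rintro a (x | y) hx
            · exact hc.supp a x hx
            · rfl
          · intro f hf
            obtain ⟨a, ha⟩ := hc.surj (fun x => f (Sum.inl x)) fun x hx => hf _ hx
            refine ⟨a, ?_⟩
            ext z
            cases z with
            | inl x => exact congrFun ha x
            | inr y => exact (hf (Sum.inr y) id).symm
      · intro i hij
        have hne : lo i ≠ hi j := by
          have : i.1 + 1 ≤ j.1 + 1 := hij
          rw [Ne, Fin.ext_iff]
          simp only [lo, hi]
          omega
        rw [Function.update_of_ne hne]
        simp only [hs2 _ hne]
        by_cases h : i = j
        · subst h
          rw [Function.update_self]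
          simp only [hs1]
          exact h7 _ (fun a x => rfl) fun a y => rfl
        · have hne' : hi i ≠ hi j := by
            rw [Ne, Fin.ext_iff]
            simp only [hi, Nat.add_right_cancel_iff]
            exact fun e => h (Fin.ext e)
          rw [Function.update_of_ne hne']
          simp only [hs2 _ hne']
          have h9 := h4 i ((hlohi _).2 ⟨hne', hij⟩)
          generalize V.map i = f at h9 ⊢
          generalize τ i = d at *
          cases d
          · rintro a (x | y)
            · exact h9 a x
            · exact (ite_self _).symm
          · rintro a (x | y)
            · exact h9 a x
            · exact (ite_self _).symm
      · rw [Function.update_self]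
        exact h8
    generalize V.map j = f at main
    generalize τ j = d at *
    cases d
    · let f : V.space (lo j) →ₗ[F] V.space (hi j) := f
      obtain ⟨X, hX, s, c, h1, h2, h3, h4, h5⟩ := ih (lo j) hj
        (l.map (Submodule.comap f) ++ [LinearMap.ker f]) (List.pairwise_append.2
          ⟨pairwise_map_of_monotone (fun _ _ h => Submodule.comap_mono h) hl, by simp, by
            intro a ha b hb
            obtain ⟨K, _, rfl⟩ := List.mem_map.1 ha
            rw [List.mem_singleton.1 hb]
            exact LinearMap.ker_le_comap f⟩)
      obtain ⟨r, q, cB, h6, h7, h8, h9, h10⟩ := exists_coord_fwd f (h3 _ le_rfl) l hl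
        (h5 _ (by simp)) fun K hK => h5 _ (by simp; exact Or.inl ⟨K, hK, rfl⟩)
      refine main X hX s c h1 h2 h3 h4 r q cB h6 h7 (fun cA h11 h12 => ?_) h10
      rintro a (x | y)
      · rw [h11]
        exact h8 a x
      · rw [h12, ite_self]
        exact h9 a y
    · let f : V.space (hi j) →ₗ[F] V.space (lo j) := f
      obtain ⟨X, hX, s, c, h1, h2, h3, h4, h5⟩ := ih (lo j) hj
        (LinearMap.range f :: l.map (Submodule.map f)) (List.pairwise_cons.2
          ⟨by
            intro b hb
            obtain ⟨K, _, rfl⟩ := List.mem_map.1 hb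
            exact LinearMap.map_le_range,
            pairwise_map_of_monotone (fun _ _ h => Submodule.map_mono h) hl⟩)
      obtain ⟨r, q, cB, h6, h7, h8, h10⟩ := exists_coord_bwd f (h3 _ le_rfl) l hl
        (h5 _ (by simp)) fun K hK => h5 _ (by simp; exact Or.inr ⟨K, hK, rfl⟩)
      refine main X hX s c h1 h2 h3 h4 r q cB h6 h7 (fun cA h11 h12 => ?_) h10
      rintro b (x | y)
      · refine (h11 _ x).trans ((h8 b x).trans ?_)
        by_cases hx : lo j ∈ s x
        · exact (if_pos hx).symm
        · refine Eq.trans ?_ (if_neg hx).symm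
          rw [← h8]
          exact (h3 _ le_rfl).supp _ _ hx
      · exact (h12 _ y).trans (if_neg id).symm

/-- Every zigzag module is a direct sum of interval modules. -/
theorem exists_decomp (V : TauMod F τ) : ∃ (X : Type) (_ : Finite X) (s : X → Set (Fin n)),
    (∀ x, (s x).OrdConnected) ∧ Decomp V s := by
  by_cases hn : n = 0
  · subst hn
    exact ⟨Empty, inferInstance, fun _ => ∅, fun x => x.elim, fun i => i.elim0,
      fun i => i.elim0, fun i => i.elim0⟩
  · obtain ⟨X, hX, s, c, h1, h2, h3, h4, -⟩ := exists_prefix_decomp V (n - 1) ⟨n - 1, by omega⟩ rfl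
      [] List.Pairwise.nil
    have h : ∀ i : Fin n, i ≤ ⟨n - 1, by omega⟩ := fun i => by
      rw [Fin.le_def]
      have := i.2
      simp only
      omega
    exact ⟨X, hX, s, h1, c, fun i => h3 i (h i), fun i => h4 i (h _)⟩

/-! ### Persistence diagrams -/

theorem exists_equiv_of_map_eq {α β : Type} {γ : Type*} [Fintype α] [Fintype β] (f : α → γ)
    (g : β → γ) (h : Finset.univ.val.map f = Finset.univ.val.map g) :
    ∃ e : α ≃ β, ∀ a, g (e a) = f a := by
  classical
  refine exists_equiv_of_card_fiber f g fun c => ?_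
  have := congrArg (Multiset.count c) h
  rw [Multiset.count_map, Multiset.count_map] at this
  rw [Nat.card_eq_fintype_card, Nat.card_eq_fintype_card, Fintype.card_subtype,
    Fintype.card_subtype, Finset.card_def, Finset.card_def, Finset.filter_val, Finset.filter_val]
  simpa only [eq_comm] using this

theorem exists_equiv_toType {α : Type} {γ : Type} [DecidableEq γ] [Fintype α] (f : α → γ)
    (S : Multiset γ) (h : Finset.univ.val.map f = S) :
    ∃ e : α ≃ S.ToType, ∀ a, (e a).1 = f a :=
  exists_equiv_of_map_eq f (fun x : S.ToType => x.1) (by rw [h]; exact S.map_univ_coe.symm)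

theorem exists_isDiagram (V : TauMod F τ) : ∃ D, IsDiagram V D := by
  obtain ⟨X, _, s, hs, h⟩ := exists_decomp V
  have := Fintype.ofFinite {x // (s x).Nonempty}
  choose b d hbd hI using fun x : {x // (s x).Nonempty} => exists_eq_Icc x.2 (hs x)
  obtain ⟨e, he⟩ := exists_equiv_toType (fun x => (b x, d x)) _ rfl
  have hval : ∀ y, Set.Icc y.1.1 y.1.2 = s (e.symm y) := fun y => by
    have := he (e.symm y)
    rw [e.apply_symm_apply] at this
    rw [this, hI]
  refine ⟨_, fun x hx => ?_, Decomp.iso (h.reindex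
    (e.trans (Equiv.subtypeUnivEquiv fun y => ?_).symm) fun x => ?_) (decomp_intervalSum _ _)⟩
  · obtain ⟨y, -, rfl⟩ := Multiset.mem_map.1 hx
    exact hbd y
  · rw [hval]
    exact (e.symm y).2
  · change Set.Icc (e x).1.1 (e x).1.2 = _
    rw [hval, e.symm_apply_apply]

theorem isDiagram_dgmIntervals (V : TauMod F τ) : IsDiagram V (dgmIntervals V) := by
  have h := exists_isDiagram V
  rw [dgmIntervals, dif_pos h]
  exact h.choose_spec

/-- The intervals of the persistence diagram, as supports. -/
def dgmSupp (V : TauMod F τ) (x : (dgmIntervals V).ToType) : Set (Fin n) := Set.Icc x.1.1 x.1.2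

theorem TauMod.Iso.symm {V W : TauMod F τ} (h : V.Iso W) : W.Iso V := by
  obtain ⟨e, he⟩ := h
  refine ⟨fun i => (e i).symm, fun i => ?_⟩
  have h := he i
  generalize V.map i = f at h ⊢
  generalize W.map i = g at h ⊢
  generalize τ i = d at *
  cases d
  · refine LinearMap.ext fun a => ?_
    obtain ⟨a, rfl⟩ := (e (lo i)).surjective a
    refine (e (hi i)).symm_apply_eq.2 ((LinearMap.congr_fun h a).symm.trans ?_)
    exact congrArg (fun z => e (hi i) ((show V.space (lo i) →ₗ[F] V.space (hi i) from f) z))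
      ((e (lo i)).symm_apply_apply a).symm
  · refine LinearMap.ext fun a => ?_
    obtain ⟨a, rfl⟩ := (e (hi i)).surjective a
    refine (e (lo i)).symm_apply_eq.2 ((LinearMap.congr_fun h a).symm.trans ?_)
    exact congrArg (fun z => e (lo i) ((show V.space (hi i) →ₗ[F] V.space (lo i) from f) z))
      ((e (hi i)).symm_apply_apply a).symm

theorem decomp_dgmSupp (V : TauMod F τ) : Decomp V (dgmSupp V) :=
  (decomp_intervalSum τ (dgmIntervals V)).of_iso (isDiagram_dgmIntervals V).2.symm

theorem dgmSupp_le (V : TauMod F τ) (x : (dgmIntervals V).ToType) : x.1.1 ≤ x.1.2 :=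
  (isDiagram_dgmIntervals V).1 _ (Multiset.coe_mem (x := x))

theorem dgmSupp_nonempty (V : TauMod F τ) (x : (dgmIntervals V).ToType) : (dgmSupp V x).Nonempty :=
  ⟨x.1.1, le_rfl, dgmSupp_le V x⟩

theorem dgmSupp_ordConnected (V : TauMod F τ) (x : (dgmIntervals V).ToType) :
    (dgmSupp V x).OrdConnected := Set.ordConnected_Icc

/-! ### Removal of simple summands -/

/-- The support which remains after the removal of simple summands. -/
def trimSupp (s : Set (Fin n)) : Set (Fin n) := {i | i ∈ s ∧ s.Nontrivial}

theorem trimSupp_of_nontrivial {s : Set (Fin n)} (h : s.Nontrivial) : trimSupp s = s := by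
  ext i; simp [trimSupp, h]

theorem trimSupp_of_not_nontrivial {s : Set (Fin n)} (h : ¬ s.Nontrivial) : trimSupp s = ∅ := by
  ext i; simp [trimSupp, h]

theorem trimSupp_nonempty {s : Set (Fin n)} : (trimSupp s).Nonempty ↔ s.Nontrivial :=
  ⟨fun ⟨_, h⟩ => h.2, fun h => ⟨h.nonempty.some, h.nonempty.some_mem, h⟩⟩

theorem trimSupp_ordConnected {s : Set (Fin n)} (h : s.OrdConnected) :
    (trimSupp s).OrdConnected := by
  by_cases hs : s.Nontrivial
  · rwa [trimSupp_of_nontrivial hs]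
  · rw [trimSupp_of_not_nontrivial hs]
    exact Set.ordConnected_empty

theorem Icc_nontrivial_iff {b d : Fin n} : (Set.Icc b d).Nontrivial ↔ b < d := by
  constructor
  · rintro ⟨i, hi, j, hj, hne⟩
    by_contra h
    exact hne (le_antisymm (hi.2.trans ((not_lt.1 h).trans hj.1))
      (hj.2.trans ((not_lt.1 h).trans hi.1)))
  · intro h
    exact ⟨b, ⟨le_rfl, h.le⟩, d, ⟨h.le, le_rfl⟩, h.ne⟩

theorem exists_equiv_filter_toType {γ : Type} [DecidableEq γ] (S : Multiset γ) (p : γ → Prop)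
    [DecidablePred p] :
    ∃ e : (S.filter p).ToType ≃ {y : S.ToType // p y.1}, ∀ x, (e x).1.1 = x.1 := by
  refine exists_equiv_of_map_eq (fun x : (S.filter p).ToType => x.1)
    (fun y : {y : S.ToType // p y.1} => y.1.1) ?_
  rw [Multiset.map_univ_coe]
  have h1 : Finset.univ.map (Function.Embedding.subtype fun y : S.ToType => p y.1) =
      Finset.univ.filter fun y : S.ToType => p y.1 := by
    ext y
    simp
  have h2 := congrArg Finset.val h1
  rw [Finset.map_val, Finset.filter_val] at h2
  conv_lhs => rw [← S.map_univ_coe, Multiset.filter_map]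
  rw [show (fun y : {y : S.ToType // p y.1} => y.1.1) = (fun y : S.ToType => y.1) ∘
    (Function.Embedding.subtype fun y : S.ToType => p y.1) from rfl, ← Multiset.map_map, h2]
  rfl

theorem Decomp.removeSimple [Finite X] {V : NMod F n} {s : X → Set (Fin n)} (h : Decomp V.2 s)
    (hs : ∀ x, (s x).OrdConnected) :
    Decomp (removeSimple V).2 (fun x => trimSupp (s x)) := by
  obtain ⟨e, he⟩ := h.unique (decomp_dgmSupp V.2) hs (dgmSupp_ordConnected V.2)
  obtain ⟨e', he'⟩ := exists_equiv_filter_toType (dgmIntervals V.2) fun x => x.1 ≠ x.2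
  let D := (dgmIntervals V.2).filter fun x => x.1 ≠ x.2
  have hD : ∀ y : D.ToType, (Set.Icc y.1.1 y.1.2).Nonempty := fun y =>
    ⟨y.1.1, le_rfl, he' y ▸ dgmSupp_le V.2 (e' y).1⟩
  have hne : ∀ x : {x // (trimSupp (s x)).Nonempty}, (s x).Nontrivial := fun x =>
    trimSupp_nonempty.1 x.2
  let f : {x // (trimSupp (s x)).Nonempty} → {y : (dgmIntervals V.2).ToType // y.1.1 ≠ y.1.2} :=
    fun x => ⟨e ⟨x.1, (hne x).nonempty⟩, by
      have h1 : (dgmSupp V.2 (e ⟨x.1, (hne x).nonempty⟩)).Nontrivial := by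
        rw [he]
        exact hne x
      exact (Icc_nontrivial_iff.1 h1).ne⟩
  have hf : Function.Bijective f := by
    constructor
    · intro x y hxy
      have h1 : e ⟨x.1, (hne x).nonempty⟩ = e ⟨y.1, (hne y).nonempty⟩ :=
        Subtype.ext (congrArg (fun z => z.1) hxy)
      exact Subtype.ext (congrArg (fun z => z.1) (e.injective h1))
    · intro y
      let x := e.symm ⟨y.1, dgmSupp_nonempty V.2 y.1⟩
      have hx : s x = dgmSupp V.2 y.1 := by rw [← he, e.apply_symm_apply]
      have hx' : (trimSupp (s x)).Nonempty := by
        rw [trimSupp_nonempty, hx]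
        exact Icc_nontrivial_iff.2 (lt_of_le_of_ne (dgmSupp_le V.2 y.1) y.2)
      refine ⟨⟨x, hx'⟩, Subtype.ext ?_⟩
      change (e x).1 = y.1
      rw [e.apply_symm_apply]
  refine (decomp_intervalSum (F := F) V.1 D).reindex ((Equiv.subtypeUnivEquiv hD).trans
    (e'.trans (Equiv.ofBijective f hf).symm)) fun y => ?_
  have h1 : f ((Equiv.ofBijective f hf).symm (e' y.1)) = e' y.1 :=
    (Equiv.ofBijective f hf).apply_symm_apply _
  set x := (Equiv.ofBijective f hf).symm (e' y.1) with hx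
  change trimSupp (s x.1) = Set.Icc y.1.1.1 y.1.1.2
  rw [trimSupp_of_nontrivial (hne x), ← he' y.1, ← h1]
  exact (he ⟨x.1, (hne x).nonempty⟩).symm

/-! ### The effect of a reflection on a single interval -/

theorem updateSupp_ordConnected {k : Fin n} {p : Prop} {s : Set (Fin n)} (hs : s.OrdConnected)
    (h1 : leftMem k s → k ∈ s → rightMem k s → p)
    (h2 : p → leftMem k s ∨ k ∈ s ∨ rightMem k s) : (updateSupp k p s).OrdConnected := by
  have step : ∀ i ∈ s, ∀ j ∈ s, ∀ m, i ≤ m → m ≤ j → m ∈ s := fun i hi j hj m h h' =>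
    hs.out hi hj ⟨h, h'⟩
  have left : ∀ i ∈ s, ∀ m ∈ s, i < k → k ≤ m → leftMem k s := by
    intro i hi m hm h h'
    rw [Fin.lt_def] at h
    rw [Fin.le_def] at h'
    refine ⟨⟨k.1 - 1, by omega⟩, step i hi m hm _ (by rw [Fin.le_def]; simp only; omega)
      (by rw [Fin.le_def]; simp only; omega), by simp only; omega⟩
  have right : ∀ i ∈ s, ∀ m ∈ s, i ≤ k → k < m → rightMem k s := by
    intro i hi m hm h h'
    rw [Fin.le_def] at h
    rw [Fin.lt_def] at h'
    have := m.2
    refine ⟨⟨k.1 + 1, by omega⟩, step i hi m hm _ (by rw [Fin.le_def]; simp only; omega)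
      (by rw [Fin.le_def]; simp only; omega), rfl⟩
  refine ⟨fun i hi j hj m hm => ?_⟩
  by_cases hmk : m = k
  · subst hmk
    rw [mem_updateSupp_self]
    by_cases hik : i = m
    · subst hik; exact mem_updateSupp_self.1 hi
    by_cases hjk : j = m
    · subst hjk; exact mem_updateSupp_self.1 hj
    rw [mem_updateSupp_of_ne hik] at hi
    rw [mem_updateSupp_of_ne hjk] at hj
    exact h1 (left i hi j hj (lt_of_le_of_ne hm.1 hik) hm.2) (step i hi j hj m hm.1 hm.2)
      (right i hi j hj hm.1 (lt_of_le_of_ne hm.2 (Ne.symm hjk)))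
  · rw [mem_updateSupp_of_ne hmk]
    by_cases hik : i = k
    · subst hik
      have hji : j ≠ i := by rintro rfl; exact hmk (le_antisymm hm.2 hm.1)
      rw [mem_updateSupp_of_ne hji] at hj
      have him : i < m := lt_of_le_of_ne hm.1 (Ne.symm hmk)
      rcases h2 (mem_updateSupp_self.1 hi) with ⟨a, ha, e⟩ | h | ⟨a, ha, e⟩
      · exact step a ha j hj m (by rw [Fin.le_def]; rw [Fin.lt_def] at him; omega) hm.2
      · exact step i h j hj m hm.1 hm.2
      · exact step a ha j hj m (by rw [Fin.le_def]; rw [Fin.lt_def] at him; omega) hm.2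
    · rw [mem_updateSupp_of_ne hik] at hi
      by_cases hjk : j = k
      · subst hjk
        have hmj : m < j := lt_of_le_of_ne hm.2 hmk
        rcases h2 (mem_updateSupp_self.1 hj) with ⟨a, ha, e⟩ | h | ⟨a, ha, e⟩
        · exact step i hi a ha m hm.1 (by rw [Fin.le_def]; rw [Fin.lt_def] at hmj; omega)
        · exact step i hi j h m hm.1 hm.2
        · exact step i hi a ha m hm.1 (by rw [Fin.le_def]; rw [Fin.lt_def] at hmj; omega)
      · rw [mem_updateSupp_of_ne hjk] at hj
        exact step i hi j hj m hm.1 hm.2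

theorem limSupp_of_mem {dl dr : Dir} {pl p pr : Prop} (h1 : pl) (h2 : p) (h3 : pr) :
    limSupp dl dr pl p pr := by
  cases dl <;> cases dr <;> simp [limSupp, h1, h2, h3]

theorem of_limSupp {dl dr : Dir} {pl p pr : Prop} (h : limSupp dl dr pl p pr) :
    pl ∨ p ∨ pr := by
  cases dl <;> cases dr <;> simp only [limSupp] at h <;> tauto

theorem colimSupp_of_mem {dl dr : Dir} {pl p pr : Prop} (h1 : pl) (h2 : p) (h3 : pr) :
    colimSupp dl dr pl p pr := by
  cases dl <;> cases dr <;> simp [colimSupp, h1, h2, h3]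

theorem of_colimSupp {dl dr : Dir} {pl p pr : Prop} (h : colimSupp dl dr pl p pr) :
    pl ∨ p ∨ pr := by
  cases dl <;> cases dr <;> simp only [colimSupp] at h <;> tauto

/-- A reflection changes the support of every interval module in at most one vertex, and the result
is again an interval or empty. -/
theorem Decomp.reflect {V : NMod F n} {s : X → Set (Fin n)} (h : Decomp V.2 s)
    (hs : ∀ x, (s x).OrdConnected) (R : Reflection n) :
    ∃ (k : Fin n) (p : X → Prop), Decomp (R.apply V).2 (fun x => updateSupp k (p x) (s x)) ∧
      ∀ x, (updateSupp k (p x) (s x)).OrdConnected := by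
  cases R with
  | limit k d₀ =>
    exact ⟨k, _, h.extrovert hs k d₀, fun x =>
      updateSupp_ordConnected (hs x) limSupp_of_mem of_limSupp⟩
  | colimit k d₀ =>
    exact ⟨k, _, h.introvert hs k d₀, fun x =>
      updateSupp_ordConnected (hs x) colimSupp_of_mem of_colimSupp⟩

/-- The endpoints of `[b, d]` and `[b', d']` differ by at most `m`, and `[b', d']` is shorter than
`[b, d]` by at most `m`. -/
def Near (m : ℕ) (b d b' d' : Fin n) : Prop :=
  b.1 ≤ b'.1 + m ∧ b'.1 ≤ b.1 + m ∧ d.1 ≤ d'.1 + m ∧ d'.1 ≤ d.1 + m ∧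
    d.1 + b'.1 ≤ d'.1 + b.1 + m

/-- Since `[b, d]` has at least two elements, one of `b`, `b + 1` stays in the support when a single
vertex changes, and likewise at the other ends. -/
theorem near_of_updateSupp {k b d b' d' : Fin n} {p : Prop}
    (h : updateSupp k p (Set.Icc b d) = Set.Icc b' d') (hbd : b < d) (hbd' : b' < d') :
    Near 1 b d b' d' := by
  have H : ∀ i : ℕ, i < n → i ≠ k.1 → (b.1 ≤ i ∧ i ≤ d.1 ↔ b'.1 ≤ i ∧ i ≤ d'.1) := by
    intro i hi hik
    have : (⟨i, hi⟩ : Fin n) ∈ updateSupp k p (Set.Icc b d) ↔ _ := mem_updateSupp_of_ne (by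
      rw [Ne, Fin.ext_iff]; exact hik)
    rw [h] at this
    exact this.symm
  have := d.2
  have := d'.2
  rw [Fin.lt_def] at hbd hbd'
  have h1 := H b.1 (by omega)
  have h2 := H (b.1 + 1) (by omega)
  have h3 := H d.1 (by omega)
  have h4 := H (d.1 - 1) (by omega)
  have h5 := H b'.1 (by omega)
  have h6 := H (b'.1 + 1) (by omega)
  have h7 := H d'.1 (by omega)
  have h8 := H (d'.1 - 1) (by omega)
  clear H h
  refine ⟨?_, ?_, ?_, ?_, ?_⟩
  · clear h1 h2 h3 h4 h7 h8; omega
  · clear h3 h4 h5 h6 h7 h8; omega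
  · clear h1 h2 h5 h6 h7 h8; omega
  · clear h1 h2 h3 h4 h5 h6; omega
  · clear h5 h6 h7 h8; omega

theorem le_of_updateSupp {k b d : Fin n} {p : Prop}
    (h : ¬ (updateSupp k p (Set.Icc b d)).Nontrivial) : d.1 ≤ b.1 + 1 := by
  by_contra hlt
  have := d.2
  apply h
  have mem : ∀ i : ℕ, ∀ hi : i < n, i ≠ k.1 → b.1 ≤ i → i ≤ d.1 →
      (⟨i, hi⟩ : Fin n) ∈ updateSupp k p (Set.Icc b d) := fun i hi hik h1 h2 =>
    (mem_updateSupp_of_ne (by rw [Ne, Fin.ext_iff]; exact hik)).2 ⟨h1, h2⟩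
  by_cases h1 : b = k
  · exact ⟨_, mem (b.1 + 1) (by omega) (by omega) (by omega) (by omega), _,
      mem (b.1 + 2) (by omega) (by omega) (by omega) (by omega), by simp [Fin.ext_iff]⟩
  · rw [Fin.ext_iff] at h1
    by_cases h2 : b.1 + 1 = k.1
    · exact ⟨_, mem b.1 (by omega) (by omega) (by omega) (by omega), _,
        mem (b.1 + 2) (by omega) (by omega) (by omega) (by omega), by simp [Fin.ext_iff]⟩
    · exact ⟨_, mem b.1 (by omega) (by omega) (by omega) (by omega), _,
        mem (b.1 + 1) (by omega) (by omega) (by omega) (by omega), by simp [Fin.ext_iff]⟩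

/-- Along a sequence of `m` reflections an interval either survives and moves by at most `m`, or it
had length at most `m`. -/
def Tracked (m : ℕ) (b d : Fin n) (t : Set (Fin n)) : Prop :=
  (t = ∅ ∧ d.1 ≤ b.1 + m) ∨ ∃ b' d', b' < d' ∧ t = Set.Icc b' d' ∧ Near m b d b' d'

theorem Tracked.ordConnected {m : ℕ} {b d : Fin n} {t : Set (Fin n)} (h : Tracked m b d t) :
    t.OrdConnected := by
  rcases h with ⟨rfl, -⟩ | ⟨_, _, -, rfl, -⟩
  · exact Set.ordConnected_empty
  · exact Set.ordConnected_Icc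

theorem Tracked.update {m : ℕ} {b d k : Fin n} {t : Set (Fin n)} (h : Tracked m b d t) {p : Prop}
    (hp : (updateSupp k p t).OrdConnected) :
    Tracked (m + 1) b d (trimSupp (updateSupp k p t)) := by
  by_cases hne : (updateSupp k p t).Nontrivial
  · rw [trimSupp_of_nontrivial hne]
    obtain ⟨b'', d'', -, e⟩ := exists_eq_Icc hne.nonempty hp
    have hbd := Icc_nontrivial_iff.1 (e ▸ hne)
    rcases h with ⟨rfl, -⟩ | ⟨b', d', hbd', rfl, hN⟩
    · -- An empty support cannot become an interval of positive length.
      obtain ⟨i, hi, j, hj, hij⟩ := hne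
      simp only [updateSupp, Set.mem_empty_iff_false, and_false, or_false] at hi hj
      exact absurd (hi.1.trans hj.1.symm) hij
    · have := near_of_updateSupp e hbd' hbd
      refine Or.inr ⟨b'', d'', hbd, e, ?_⟩
      unfold Near at *
      omega
  · rw [trimSupp_of_not_nontrivial hne]
    refine Or.inl ⟨rfl, ?_⟩
    rcases h with ⟨-, h⟩ | ⟨b', d', hbd', rfl, hN⟩
    · omega
    · have := le_of_updateSupp hne
      unfold Near at hN
      omega

theorem exists_tracked (V : NMod F n) (l : List (Reflection n)) :
    ∃ t : (dgmIntervals V.2).ToType → Set (Fin n), Decomp (applySeq V l).2 t ∧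
      ∀ x, Tracked l.length x.1.1 x.1.2 (t x) := by
  induction l with
  | nil =>
    refine ⟨_, (decomp_dgmSupp V.2).removeSimple (dgmSupp_ordConnected V.2), fun x => ?_⟩
    by_cases h : (dgmSupp V.2 x).Nontrivial
    · rw [trimSupp_of_nontrivial h]
      exact Or.inr ⟨_, _, Icc_nontrivial_iff.1 h, rfl, by simp [Near]⟩
    · rw [trimSupp_of_not_nontrivial h]
      have := mt Icc_nontrivial_iff.2 h
      exact Or.inl ⟨rfl, by simpa using this⟩
  | cons R l ih =>
    obtain ⟨t, ht, hN⟩ := ih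
    obtain ⟨k, p, h1, h2⟩ := ht.reflect (fun x => (hN x).ordConnected) R
    exact ⟨_, h1.removeSimple h2, fun x => (hN x).update (h2 x)⟩

/-! ### Every module can be reflected to zero -/

theorem Decomp.subsingleton {V : TauMod F τ} {s : X → Set (Fin n)} (h : Decomp V s)
    (hs : ∀ x, s x = ∅) (i : Fin n) : Subsingleton (V.space i) := by
  obtain ⟨c, hc⟩ := h
  have : ∀ a : V.space i, a = 0 := fun a => (hc.coord i).inj a <| by
    ext x
    exact (hc.coord i).supp a x (by simp [hs])
  exact ⟨fun a b => (this a).trans (this b).symm⟩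

/-- Zero modules of any two types are equivalent, `m` being the number of arrows to be reversed. -/
theorem equivalent_of_subsingleton (m : ℕ) : ∀ {τ τ' : ZType n} (V : TauMod F τ) (W : TauMod F τ'),
    (∀ i, Subsingleton (V.space i)) → (∀ i, Subsingleton (W.space i)) →
    Nat.card {i // τ i ≠ τ' i} = m → Equivalent (⟨τ, V⟩ : NMod F n) ⟨τ', W⟩ := by
  induction m with
  | zero =>
    intro τ τ' V W hV hW h
    have he : IsEmpty {i // τ i ≠ τ' i} := Finite.card_eq_zero_iff.1 h
    obtain rfl : τ = τ' := funext fun i => by_contra fun hi => he.elim ⟨i, hi⟩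
    refine .of_iso ⟨fun i => 0, fun i => ?_⟩
    generalize V.map i = f
    generalize W.map i = g
    generalize τ i = d at *
    cases d
    · exact LinearMap.ext fun a => Subsingleton.elim _ _
    · exact LinearMap.ext fun a => Subsingleton.elim _ _
  | succ m ih =>
    intro τ τ' V W hV hW h
    obtain ⟨k, hk⟩ : Nonempty {i // τ i ≠ τ' i} := by
      by_contra hne
      rw [not_nonempty_iff] at hne
      simp at h
    have hiso : StructMap.IsIso (τ k) (V.map k) := by
      generalize V.map k = f
      generalize τ k = d at *
      cases d
      · exact ⟨fun a b _ => Subsingleton.elim _ _, fun b => ⟨0, Subsingleton.elim _ _⟩⟩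
      · exact ⟨fun a b _ => Subsingleton.elim _ _, fun b => ⟨0, Subsingleton.elim _ _⟩⟩
    refine .of_reverse V k hiso (ih _ W hV hW ?_)
    have hrev : τ.reverse k k = τ' k := by
      simp only [ZType.reverse, if_true]
      generalize τ k = d at hk
      generalize τ' k = d' at hk
      cases d <;> cases d' <;> simp_all [Dir.rev]
    have h1 : Finset.univ.filter (fun i => τ.reverse k i ≠ τ' i) =
        (Finset.univ.filter fun i => τ i ≠ τ' i).erase k := by
      ext i
      by_cases hi : i = k
      · subst hi
        simp [hrev]
      · have : τ.reverse k i = τ i := if_neg hi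
        rw [Finset.mem_erase, Finset.mem_filter, Finset.mem_filter, this]
        simp [hi]
    rw [Nat.card_eq_fintype_card, Fintype.card_subtype] at h ⊢
    rw [h1, Finset.card_erase_of_mem (by simpa using hk), h]
    rfl

/-- Limits at the vertices from the last to the first make all arrows point to the right. -/
theorem exists_applySeq_fwd (V : NMod F n) (m : ℕ) (hm : m ≤ n) : ∃ l : List (Reflection n),
    ∀ i : Fin (n - 1), n ≤ i.1 + m → (applySeq V l).1 i = .fwd := by
  induction m with
  | zero => exact ⟨[], fun i hi => by omega⟩
  | succ m ih =>
    obtain ⟨l, hl⟩ := ih (by omega)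
    refine ⟨.limit ⟨n - (m + 1), by omega⟩ .fwd :: l, fun i hi' => ?_⟩
    change ZType.place ⟨n - (m + 1), _⟩ .bwd .fwd (applySeq V l).1 i = _
    simp only [ZType.place, hi, lo, Fin.mk.injEq]
    rw [if_neg (by omega)]
    split_ifs with h
    · rfl
    · exact hl i (by omega)

theorem leftArrow_dir_eq_fwd {V : TauMod F τ} {k : Fin n} (h : ∀ i, hi i = k → τ i = .fwd) :
    (V.leftArrow .fwd k).dir = .fwd := by
  obtain ⟨k, hk⟩ := k
  cases k with
  | zero => rfl
  | succ j => exact h ⟨j, by omega⟩ rfl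

theorem rightArrow_dir_eq_fwd {V : TauMod F τ} {k : Fin n} (h : ∀ i, lo i = k → τ i = .fwd) :
    (V.rightArrow .fwd k).dir = .fwd := by
  unfold TauMod.rightArrow
  split_ifs with hk
  · exact h ⟨k.1, hk⟩ rfl
  · rfl

/-- If all arrows point to the right, then limits at the vertices from the first to the last, with a
zero map from `0` to the first space, remove the vertices one by one from all intervals. -/
theorem exists_applySeq_support (V : NMod F n) (m : ℕ) (hm : m ≤ n) :
    ∃ l : List (Reflection n), (∀ i : Fin (n - 1), m ≤ i.1 + 1 → (applySeq V l).1 i = .fwd) ∧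
      ∃ t : (dgmIntervals V.2).ToType → Set (Fin n), Decomp (applySeq V l).2 t ∧
        (∀ x, (t x).OrdConnected) ∧ ∀ x, ∀ i ∈ t x, m ≤ i.1 := by
  induction m with
  | zero =>
    obtain ⟨l, hl⟩ := exists_applySeq_fwd V n le_rfl
    obtain ⟨t, ht, hN⟩ := exists_tracked V l
    exact ⟨l, fun i _ => hl i (by omega), t, ht, fun x => (hN x).ordConnected,
      fun _ _ _ => Nat.zero_le _⟩
  | succ m ih =>
    obtain ⟨l, hl, t, ht, hs, hmem⟩ := ih (by omega)
    let k : Fin n := ⟨m, by omega⟩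
    have h1 := ht.extrovert hs k .fwd
    rw [leftArrow_dir_eq_fwd fun j hj => hl j (by rw [Fin.ext_iff] at hj; exact hj.ge),
      rightArrow_dir_eq_fwd fun j hj => hl j (by
        rw [Fin.ext_iff] at hj
        simp only [lo, k] at hj
        omega)] at h1
    have h2 : ∀ x, (updateSupp k (limSupp .fwd .fwd (leftMem k (t x)) (k ∈ t x)
        (rightMem k (t x))) (t x)).OrdConnected := fun x =>
      updateSupp_ordConnected (hs x) limSupp_of_mem of_limSupp
    refine ⟨.limit k .fwd :: l, fun i hi' => ?_, _,
      Decomp.removeSimple (V := (Reflection.limit k .fwd).apply (applySeq V l)) h1 h2,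
      fun x => trimSupp_ordConnected (h2 x), fun x i hi' => ?_⟩
    · change ZType.place k .bwd .fwd (applySeq V l).1 i = _
      simp only [ZType.place, hi, lo, Fin.mk.injEq, k]
      rw [if_neg (by omega)]
      split_ifs with h
      · rfl
      · exact hl i (by omega)
    · have h3 := hi'.1
      by_cases hik : i = k
      · subst hik
        obtain ⟨j, hj, e⟩ := mem_updateSupp_self.1 h3
        have := hmem x j hj
        simp only [k] at e
        omega
      · have := hmem x i ((mem_updateSupp_of_ne hik).1 h3)
        have : i.1 ≠ m := fun e => hik (Fin.ext e)
        omega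

/-- The infimum which defines the reflection distance runs over a nonempty set: the zero module,
whatever its type, is equivalent to a summand of every module. -/
theorem exists_precSim (V W : NMod F n) : ∃ l, PrecSim (applySeq V l) W := by
  obtain ⟨l, -, t, ht, -, hmem⟩ := exists_applySeq_support V n le_rfl
  have he : IsEmpty (0 : Multiset (Fin n × Fin n)).ToType :=
    ⟨fun x => Multiset.notMem_zero _ (Multiset.coe_mem (x := x))⟩
  have h0 := decomp_intervalSum (F := F) W.1 0
  refine ⟨l, intervalSum F W.1 0, equivalent_of_subsingleton _ _ _ (ht.subsingleton fun x => ?_)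
    (h0.subsingleton fun x => he.elim x) rfl, W.2, ?_⟩
  · exact Set.eq_empty_of_forall_notMem fun i hi => absurd i.2 (not_lt.2 (hmem x i hi))
  · have h1 := decomp_dgmSupp W.2
    refine h1.iso ((h0.sum h1).reindex ((Equiv.emptySum _ _).subtypeEquiv ?_) ?_)
    · rintro (x | x)
      · exact he.elim x
      · rfl
    · rintro ⟨x | x, hx⟩
      · exact (he.false x).elim
      · rfl

/-! ### Matchings -/

/-- The elements which are reached by alternating paths that start outside the range of `g`. -/
inductive Reached {S T : Type} (f : S → T → Prop) (g : T → S → Prop) : S → Prop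
  | start (s : S) : (∀ t, ¬ g t s) → Reached f g s
  | step (s s' : S) (t : T) : Reached f g s → f s t → g t s' → Reached f g s'

/-- Two matchings `f` and `g`, in opposite directions, contain a matching which covers
everything that `f` covers on the left and everything that `g` covers on the right. -/
theorem exists_common_matching {S T : Type} (f : Matching S T) (g : Matching T S) :
    ∃ h : Matching S T, (∀ s t, h.rel s t → f.rel s t ∨ g.rel t s) ∧
      (∀ s t, f.rel s t → ∃ t', h.rel s t') ∧ ∀ t s, g.rel t s → ∃ s', h.rel s' t := by
  refine ⟨⟨fun s t => (Reached f.rel g.rel s ∧ f.rel s t) ∨ (¬ Reached f.rel g.rel s ∧ g.rel t s),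
    ?_, ?_⟩, ?_, ?_, ?_⟩
  · rintro s t t' (⟨h1, h2⟩ | ⟨h1, h2⟩) (⟨h3, h4⟩ | ⟨h3, h4⟩)
    · exact f.right_unique _ _ _ h2 h4
    · exact absurd h1 h3
    · exact absurd h3 h1
    · exact g.left_unique _ _ _ h2 h4
  · rintro s s' t (⟨h1, h2⟩ | ⟨h1, h2⟩) (⟨h3, h4⟩ | ⟨h3, h4⟩)
    · exact f.left_unique _ _ _ h2 h4
    · exact absurd (.step s s' t h1 h2 h4) h3
    · exact absurd (.step s' s t h3 h4 h2) h1
    · exact g.right_unique _ _ _ h2 h4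
  · rintro s t (⟨_, h⟩ | ⟨_, h⟩)
    · exact Or.inl h
    · exact Or.inr h
  · intro s t hst
    by_cases hs : Reached f.rel g.rel s
    · exact ⟨t, Or.inl ⟨hs, hst⟩⟩
    · by_contra hne
      push Not at hne
      exact hs (.start s fun t' ht' => hne t' (Or.inr ⟨hs, ht'⟩))
  · intro t s hts
    by_cases hs : Reached f.rel g.rel s
    · cases hs with
      | start _ h => exact absurd hts (h t)
      | step s' _ t' h1 h2 h3 =>
        obtain rfl := g.left_unique _ _ _ hts h3
        exact ⟨s', Or.inl ⟨h1, h2⟩⟩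
    · exact ⟨s, Or.inr ⟨hs, hts⟩⟩

/-- If `m` reflections turn `V` into a part of `W`, then the intervals of `V` of length greater than
`m` can be matched with intervals of `W` at distance at most `m`. -/
theorem exists_matching_of_precSim {V W : NMod F n} {l : List (Reflection n)}
    (h : PrecSim (applySeq V l) W) :
    ∃ M : Matching (dgmIntervals V.2).ToType (dgmIntervals W.2).ToType,
      (∀ x y, M.rel x y → Near l.length x.1.1 x.1.2 y.1.1 y.1.2) ∧
      ∀ x, (∀ y, ¬ M.rel x y) → x.1.2.1 ≤ x.1.1.1 + l.length := by
  obtain ⟨t, ht, hN⟩ := exists_tracked V l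
  obtain ⟨W', hW', U, hU⟩ := h
  obtain ⟨Z, _, u, hu, hUu⟩ := exists_decomp U
  have h1 : Decomp W' t := ht.of_equivalent hW'
  obtain ⟨e, he⟩ := ((h1.sum hUu).of_iso hU.symm).unique (decomp_dgmSupp W.2)
    (by rintro (x | z); exacts [(hN x).ordConnected, hu z]) (dgmSupp_ordConnected W.2)
  refine ⟨⟨fun x y => ∃ hx : (t x).Nonempty, e ⟨Sum.inl x, hx⟩ = y, ?_, ?_⟩, ?_, ?_⟩
  · rintro x y y' ⟨hx, rfl⟩ ⟨hx', rfl⟩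
    rfl
  · rintro x x' y ⟨hx, rfl⟩ ⟨hx', h⟩
    have := congrArg Subtype.val (e.injective (Subtype.ext h))
    exact (Sum.inl_injective this).symm
  · rintro x _ ⟨hx, rfl⟩
    have h2 : dgmSupp W.2 (e ⟨Sum.inl x, hx⟩) = t x := he _
    have h3 := dgmSupp_le W.2 (e ⟨Sum.inl x, hx⟩)
    generalize (e ⟨Sum.inl x, hx⟩).1 = y at h2 h3 ⊢
    rcases hN x with ⟨h, -⟩ | ⟨b', d', hbd, h, hnear⟩
    · exact absurd h hx.ne_empty
    · rw [h] at h2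
      obtain ⟨h4, h5⟩ := (Set.Icc_eq_Icc_iff h3).1 h2
      rw [h4, h5]
      exact hnear
  · intro x hx
    rcases hN x with ⟨-, h⟩ | ⟨b', d', hbd, h, -⟩
    · exact h
    · exact absurd ⟨by rw [h]; exact ⟨b', le_rfl, hbd.le⟩, rfl⟩ (hx _)

theorem seqCost_one (l : List (Reflection n)) : seqCost 1 l = l.length := by
  unfold seqCost
  split_ifs with h
  · simp [h]
  · simp

theorem diagCost_infty (r : ℝ × ℝ) : diagCost ∞ r = |r.2 - r.1| / 2 := by
  simp [diagCost]

theorem matchingCost_nonneg {p : ℝ≥0∞} {S T : Multiset (ℝ × ℝ)} (M : Matching S.ToType T.ToType) :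
    0 ≤ matchingCost p M := by
  refine le_max_of_le_right (le_max_of_le_left (Real.iSup_nonneg fun s => ?_))
  unfold diagCost
  positivity

theorem bottleneckDist_le {p : ℝ≥0∞} {S T : Multiset (ℝ × ℝ)} (M : Matching S.ToType T.ToType) :
    bottleneckDist p S T ≤ matchingCost p M :=
  ciInf_le ⟨0, by rintro _ ⟨M, rfl⟩; exact matchingCost_nonneg M⟩ M

theorem exists_equiv_dgm (V : NMod F n) : ∃ e : (dgmIntervals V.2).ToType ≃ (dgm V).ToType,
    ∀ x, (e x).1 = (((x.1.1 : ℕ) : ℝ) + 1, ((x.1.2 : ℕ) : ℝ) + 1) := by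
  refine exists_equiv_toType (fun x : (dgmIntervals V.2).ToType =>
    (((x.1.1 : ℕ) : ℝ) + 1, ((x.1.2 : ℕ) : ℝ) + 1)) (dgm V) ?_
  conv_rhs => rw [dgm, ← (dgmIntervals V.2).map_univ_coe, Multiset.map_map]
  rfl

theorem Near.abs_le {m : ℕ} {b d b' d' : Fin n} (h : Near m b d b' d') :
    |((b : ℕ) : ℝ) - (b' : ℕ)| ≤ m ∧ |((d : ℕ) : ℝ) - (d' : ℕ)| ≤ m := by
  obtain ⟨h1, h2, h3, h4, -⟩ := h
  have h1 : (b.1 : ℝ) ≤ b'.1 + m := by exact_mod_cast h1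
  have h2 : (b'.1 : ℝ) ≤ b.1 + m := by exact_mod_cast h2
  have h3 : (d.1 : ℝ) ≤ d'.1 + m := by exact_mod_cast h3
  have h4 : (d'.1 : ℝ) ≤ d.1 + m := by exact_mod_cast h4
  constructor <;> rw [_root_.abs_le] <;> constructor <;> linarith

theorem diagCost_le {m : ℕ} {b d : Fin n} (h1 : b ≤ d) (h2 : d.1 ≤ b.1 + m) :
    diagCost ∞ (((b : ℕ) : ℝ) + 1, ((d : ℕ) : ℝ) + 1) ≤ m := by
  have h1 : (b.1 : ℝ) ≤ d.1 := by exact_mod_cast h1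
  have h2 : (d.1 : ℝ) ≤ b.1 + m := by exact_mod_cast h2
  rw [diagCost_infty, abs_of_nonneg (by simp only; linarith)]
  simp only
  linarith

theorem bottleneckDist_le_of_precSim {V W : NMod F n} {l l' : List (Reflection n)}
    (h : PrecSim (applySeq V l) W) (h' : PrecSim (applySeq W l') V) :
    bottleneckDist ∞ (dgm V) (dgm W) ≤ max (l.length : ℝ) l'.length := by
  obtain ⟨f, hf1, hf2⟩ := exists_matching_of_precSim h
  obtain ⟨g, hg1, hg2⟩ := exists_matching_of_precSim h'
  obtain ⟨M, hM1, hM2, hM3⟩ := exists_common_matching f g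
  obtain ⟨e, he⟩ := exists_equiv_dgm V
  obtain ⟨e', he'⟩ := exists_equiv_dgm W
  let N : Matching (dgm V).ToType (dgm W).ToType :=
    ⟨fun p q => M.rel (e.symm p) (e'.symm q),
      fun p q q' h1 h2 => e'.symm.injective (M.right_unique _ _ _ h1 h2),
      fun p p' q h1 h2 => e.symm.injective (M.left_unique _ _ _ h1 h2)⟩
  have h0 : (0 : ℝ) ≤ max (l.length : ℝ) l'.length := le_max_of_le_left (Nat.cast_nonneg _)
  refine (bottleneckDist_le N).trans (max_le ?_ (max_le ?_ ?_))
  · refine Real.iSup_le ?_ h0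
    rintro ⟨⟨p, q⟩, hpq⟩
    obtain ⟨x, rfl⟩ := e.surjective p
    obtain ⟨y, rfl⟩ := e'.surjective q
    have hxy : M.rel x y := by simpa [N] using hpq
    have key : |((x.1.1 : ℕ) : ℝ) - (y.1.1 : ℕ)| ≤ max (l.length : ℝ) l'.length ∧
        |((x.1.2 : ℕ) : ℝ) - (y.1.2 : ℕ)| ≤ max (l.length : ℝ) l'.length := by
      rcases hM1 x y hxy with h | h
      · have := (hf1 x y h).abs_le
        exact ⟨le_max_of_le_left this.1, le_max_of_le_left this.2⟩
      · have := (hg1 y x h).abs_le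
        rw [abs_sub_comm, abs_sub_comm ((y.1.2 : ℕ) : ℝ)] at this
        exact ⟨le_max_of_le_right this.1, le_max_of_le_right this.2⟩
    simp only [he, he']
    rw [WithLp.prod_norm_eq_sup]
    exact max_le (by simpa using key.1) (by simpa using key.2)
  · refine Real.iSup_le ?_ h0
    rintro ⟨p, hp⟩
    obtain ⟨x, rfl⟩ := e.surjective p
    simp only [he]
    refine le_max_of_le_left (diagCost_le (dgmSupp_le V.2 x) (hf2 x fun y hxy => ?_))
    obtain ⟨y', hy'⟩ := hM2 x y hxy
    exact hp (e' y') (by simpa [N] using hy')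
  · refine Real.iSup_le ?_ h0
    rintro ⟨q, hq⟩
    obtain ⟨y, rfl⟩ := e'.surjective q
    simp only [he']
    refine le_max_of_le_right (diagCost_le (dgmSupp_le W.2 y) (hg2 y fun x hxy => ?_))
    obtain ⟨x', hx'⟩ := hM3 y x hxy
    exact hq (e x') (by simpa [N] using hx')

end Zigzag

theorem mainTheorem5 {F : Type*} [Field F] {n : ℕ} (V W : Zigzag.NMod F n) :
    Zigzag.bottleneckDist ∞ (Zigzag.dgm V) (Zigzag.dgm W) ≤ Zigzag.reflectionDist 1 V W := by
  obtain ⟨l, hl⟩ := Zigzag.exists_precSim V W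
  obtain ⟨l', hl'⟩ := Zigzag.exists_precSim W V
  refine le_csInf ⟨_, l, l', hl, hl', rfl⟩ ?_
  rintro _ ⟨l, l', h, h', rfl⟩
  rw [Zigzag.seqCost_one, Zigzag.seqCost_one]
  exact Zigzag.bottleneckDist_le_of_precSim h h'
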